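/- By a space we mean a metric space $(X,d)$, with $d$ allowed to take the value $\infty$, which has bounded geometry ($\sup_{x}|B(x,R)|<\infty$ for all $R\in(0,\infty)$), has at most countably many coarse components (the classes $X_n$ of the relation $d(x,y)<\infty$), and is monogenic. Here $E\subseteq X\times X$ is controlled if $\sup_{(x,y)\in E}d(x,y)<\infty$; it is a controlled generating set if moreover every controlled $F\subseteq X\times X$ satisfies $F\subseteq E^{\circ n}$ for some $n\ge 1$; and $X$ is monogenic if such an $E$ exists. Let $\mathbb{C}_u[X]$ be the $*$-algebra of matrices $(T_{x,y})_{x,y\in X}$ with uniformly bounded complex entries and controlled support. A representation is a unital $*$-homomorphism $\pi:\mathbb{C}_u[X]\to\mathcal{B}(\mathcal{H})$ with $\mathcal{H}$ a Hilbert space, and $C^*_{u,\max}(X)$ is the completion of $\mathbb{C}_u[X]$ for the norm $\|T\|=\sup_\pi\|\pi(T)\|$. A partial translation is a matrix $v\in\mathbb{C}_u[X]$ given by $v_{x,y}=1$ if $t(y)=x$ and $v_{x,y}=0$ otherwise, where $t:A\to B$ is a bijection between subsets of $X$ with controlled graph. Let $\mathcal{H}^\pi=\{\xi\in\mathcal{H}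 : \pi(v)\xi=\pi(vv^*)\xi \text{ for every partial translation } v\}$. The space $X$ has Property (T) if for every controlled generating set $E$ there is $c>0$ such that for every representation $\pi$ and every $\xi\in(\mathcal{H}^\pi)^\perp$ there is a partial translation $v$ with support in $E$ and $\|(\pi(v)-\pi(vv^*))\xi\|\ge c\|\xi\|$. A Kazhdan projection of $C^*_{u,\max}(X)$ is a projection $P\in C^*_{u,\max}(X)$ such that, for every representation $\pi$ (extended to $C^*_{u,\max}(X)$ by continuity), $\pi(P)$ is the orthogonal projection onto $\mathcal{H}^\pi$. Finally let $Q_n:C^*_{u,\max}(X)\to C^*_{u,\max}(X_n)$ be the continuous extension of the restriction map $\mathbb{C}_u[X]\to\mathbb{C}_u[X_n]$, $T\mapsto T\mathbb{1}_{X_n}=(T_{x,y})_{x,y\in X_n}$. Corollary. Let $X$ be a space with coarse components $(X_n)_n$, and suppose that $X$ has Property (T). Then every $X_n$ has Property (T). Moreover, $C^*_{u,\max}(X)$ has exactly one Kazhdan projection $P$ and, for every $n$, $Q_n(P)$ is the Kazhdan projection of $C^*_{u,\max}(X_n)$, it belongs to (the image of) $\mathbb{C}_u[X_n]$, and its entries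 are, for all $x,y\in X_n$, $$Q_n(P)_{x,y}=\begin{cases}\frac{1}{|X_n|} & \text{if } X_n \text{ is finite},\\ 0 & \text{if } X_n \text{ is infinite}.\end{cases}$$ -/

import Mathlib

open scoped NNReal ENNReal

universe u

noncomputable section

namespace Coarse

/-! ## Coarse geometry -/

section Geometry

variable {X : Type u} [EMetricSpace X]

/-- The tube of diameter `R`. The distance of `X` may take the value `∞`. -/
def tube (X : Type u) [EMetricSpace X] (R : ℝ≥0) : Set (X × X) :=
  {p | edist p.1 p.2 ≤ R}

/-- A subset of `X × X` is controlled if it is contained in a tube of finite diameter. -/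
def IsControlled (E : Set (X × X)) : Prop :=
  ∃ R : ℝ≥0, 0 < R ∧ E ⊆ tube X R

/-- Composition `E ∘ F` of subsets of `X × X`. -/
def setComp (E F : Set (X × X)) : Set (X × X) :=
  {p | ∃ z, (p.1, z) ∈ E ∧ (z, p.2) ∈ F}

/-- The iterated composition `E^{∘ n}`; by convention `E^{∘ 0}` is the diagonal, so that
`E^{∘ 1} = E` and `E^{∘ (n+1)} = E ∘ E^{∘ n}`. -/
def setIter (E : Set (X × X)) : ℕ → Set (X × X)
  | 0 => {p | p.1 = p.2}
  | n + 1 => setComp E (setIter E n)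

/-- A controlled set is generating if every controlled set is contained in one of its iterated
compositions. -/
def IsControlledGenerating (E : Set (X × X)) : Prop :=
  IsControlled E ∧ ∀ F : Set (X × X), IsControlled F → ∃ n : ℕ, 1 ≤ n ∧ F ⊆ setIter E n

/-- The index set of the coarse components of `X`: the quotient of `X` by the relation
`d(x, y) < ∞`. -/
abbrev Components (X : Type u) [EMetricSpace X] : Type u :=
  Quotient (Metric.edistLtTopSetoid : Setoid X)

/-- The coarse component with index `n`, with the metric of `X`. -/
abbrev Component (X : Type u) [EMetricSpace X] (n : Components X) : Type u :=
  {x : X // (Quotient.mk _ x : Components X) = n}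

/-- A *space*: a bounded geometry, monogenic metric space (with distances in `[0, ∞]`) with at most
countably many coarse components. -/
class CoarseSpace (X : Type u) [EMetricSpace X] : Prop where
  bounded_geometry : ∀ R : ℝ≥0, 0 < R → ∃ N : ℕ, ∀ x : X, (Metric.closedEBall x R).encard ≤ N
  monogenic : ∃ E : Set (X × X), IsControlledGenerating E
  countable_components : Countable (Components X)

theorem component_edist_lt {n : Components X} (x y : Component X n) :
    edist (x : X) (y : X) < ⊤ :=
  Quotient.exact (x.2.trans y.2.symm)

theorem mem_component_of_edist_lt {n : Components X} (x : Component X n) {y : X}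
    (h : edist (x : X) y < ⊤) : (Quotient.mk _ y : Components X) = n := by
  rw [← x.2]
  refine (Quotient.sound ?_).symm
  exact h

theorem setIter_component {E : Set (X × X)} (hE : IsControlled E) {n : Components X} (k : ℕ) :
    ∀ x y : Component X n, ((x : X), (y : X)) ∈ setIter E k →
      (x, y) ∈ setIter {p : Component X n × Component X n | ((p.1 : X), (p.2 : X)) ∈ E} k := by
  obtain ⟨R, -, hR⟩ := hE
  induction k with
  | zero => intro x y h; exact Subtype.ext h
  | succ k ih =>
    rintro x y ⟨z, hz1, hz2⟩
    have hlt : edist (x : X) z < ⊤ := lt_of_le_of_lt (hR hz1) ENNReal.coe_lt_top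
    exact ⟨⟨z, mem_component_of_edist_lt x hlt⟩, hz1, ih ⟨z, _⟩ y hz2⟩

/-- A coarse component of a space is a space. -/
instance [CoarseSpace X] (n : Components X) : CoarseSpace (Component X n) where
  bounded_geometry R hR := by
    obtain ⟨N, hN⟩ := CoarseSpace.bounded_geometry (X := X) R hR
    refine ⟨N, fun x => le_trans ?_ (hN x)⟩
    rw [← Subtype.val_injective.encard_image]
    apply Set.encard_le_encard
    rintro _ ⟨y, hy, rfl⟩
    exact hy
  monogenic := by
    obtain ⟨E, hE, hgen⟩ := CoarseSpace.monogenic (X := X)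
    refine ⟨{p | ((p.1 : X), (p.2 : X)) ∈ E}, ?_, ?_⟩
    · obtain ⟨R, h0, hR⟩ := hE
      exact ⟨R, h0, fun p hp => hR hp⟩
    · rintro F ⟨R, h0, hR⟩
      obtain ⟨k, hk, hF⟩ := hgen ((fun p : Component X n × Component X n =>
        ((p.1 : X), (p.2 : X))) '' F) ⟨R, h0, by rintro _ ⟨p, hp, rfl⟩; exact hR hp⟩
      exact ⟨k, hk, fun p hp => setIter_component hE k p.1 p.2 (hF ⟨p, hp, rfl⟩)⟩
  countable_components := by
    have : Subsingleton (Components (Component X n)) := by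
      refine ⟨fun a b => ?_⟩
      induction a using Quotient.inductionOn with | _ a => ?_
      induction b using Quotient.inductionOn with | _ b => ?_
      exact Quotient.sound (component_edist_lt a b)
    infer_instance

theorem IsControlled.union {E F : Set (X × X)} (hE : IsControlled E) (hF : IsControlled F) :
    IsControlled (E ∪ F) := by
  obtain ⟨R, h0, hR⟩ := hE
  obtain ⟨S, -, hS⟩ := hF
  refine ⟨R + S, by positivity, ?_⟩
  rintro p (hp | hp)
  · exact le_trans (b := (R : ℝ≥0∞)) (hR hp) (by push_cast; exact le_self_add)
  · exact le_trans (b := (S : ℝ≥0∞)) (hS hp) (by push_cast; exact le_add_self)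

theorem IsControlled.mono {E F : Set (X × X)} (hF : IsControlled F) (h : E ⊆ F) :
    IsControlled E := by
  obtain ⟨R, h0, hR⟩ := hF
  exact ⟨R, h0, h.trans hR⟩

theorem IsControlled.comp {E F : Set (X × X)} (hE : IsControlled E) (hF : IsControlled F) :
    IsControlled (setComp E F) := by
  obtain ⟨R, h0, hR⟩ := hE
  obtain ⟨S, -, hS⟩ := hF
  refine ⟨R + S, by positivity, ?_⟩
  rintro p ⟨z, h1, h2⟩
  refine (edist_triangle p.1 z p.2).trans ?_
  push_cast
  exact add_le_add (hR h1) (hS h2)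

theorem IsControlled.swap {E : Set (X × X)} (hE : IsControlled E) :
    IsControlled {p : X × X | (p.2, p.1) ∈ E} := by
  obtain ⟨R, h0, hR⟩ := hE
  refine ⟨R, h0, fun p hp => ?_⟩
  have := hR hp
  simp only [tube, Set.mem_ofPred_eq] at this ⊢
  rwa [edist_comm]

theorem isControlled_diag : IsControlled {p : X × X | p.1 = p.2} :=
  ⟨1, one_pos, fun p (hp : p.1 = p.2) => by simp [tube, hp]⟩

theorem IsControlled.row [CoarseSpace X] {E : Set (X × X)} (hE : IsControlled E) :
    ∃ N : ℕ, ∀ x : X, {y | (x, y) ∈ E}.encard ≤ N := by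
  obtain ⟨R, h0, hR⟩ := hE
  obtain ⟨N, hN⟩ := CoarseSpace.bounded_geometry (X := X) R h0
  refine ⟨N, fun x => le_trans (Set.encard_le_encard fun y hy => ?_) (hN x)⟩
  rw [Metric.mem_closedEBall']
  exact hR hy

end Geometry

/-! ## The translation algebra -/

/-- The translation algebra `ℂ_u[X]`: the `X × X` matrices with uniformly bounded complex entries
and controlled support. -/
@[ext]
structure TranslationAlgebra (X : Type u) [EMetricSpace X] where
  /-- the entries `T_{x,y}` -/
  entry : X → X → ℂ
  bounded : ∃ C : ℝ, ∀ x y, ‖entry x y‖ ≤ C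
  controlled : IsControlled {p : X × X | entry p.1 p.2 ≠ 0}

namespace TranslationAlgebra

theorem exists_ne_of_finsum {X : Type u} {f : X → ℂ} (h : ∑ᶠ z, f z ≠ 0) : ∃ z, f z ≠ 0 := by
  by_contra hf
  push Not at hf
  exact h (finsum_eq_zero_of_forall_eq_zero hf)

section Algebra

variable {X : Type u} [EMetricSpace X]

/-- The support of a matrix. -/
def supp (T : TranslationAlgebra X) : Set (X × X) := {p | T.entry p.1 p.2 ≠ 0}

instance : Zero (TranslationAlgebra X) where
  zero :=
    { entry := fun _ _ => 0
      bounded := ⟨0, by simp⟩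
      controlled := isControlled_diag.mono (by simp) }

instance : Add (TranslationAlgebra X) where
  add T S :=
    { entry := fun x y => T.entry x y + S.entry x y
      bounded := by
        obtain ⟨C, hC⟩ := T.bounded
        obtain ⟨D, hD⟩ := S.bounded
        exact ⟨C + D, fun x y => (norm_add_le _ _).trans (add_le_add (hC x y) (hD x y))⟩
      controlled := (T.controlled.union S.controlled).mono (by
        intro p hp
        by_contra h
        simp only [Set.mem_union, Set.mem_ofPred_eq, not_or, not_not] at h
        exact hp (by simp [h])) }

instance : SMul ℂ (TranslationAlgebra X) where
  smul c T :=
    { entry := fun x y => c * T.entry x y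
      bounded := by
        obtain ⟨C, hC⟩ := T.bounded
        refine ⟨‖c‖ * C, fun x y => ?_⟩
        rw [norm_mul]
        exact mul_le_mul_of_nonneg_left (hC x y) (norm_nonneg c)
      controlled := T.controlled.mono (fun p hp => right_ne_zero_of_mul hp) }

instance : Neg (TranslationAlgebra X) where
  neg T :=
    { entry := fun x y => - T.entry x y
      bounded := by simpa using T.bounded
      controlled := by simpa using T.controlled }

open Classical in
instance : One (TranslationAlgebra X) where
  one :=
    { entry := fun x y => if x = y then 1 else 0
      bounded := ⟨1, fun x y => by split_ifs <;> simp⟩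
      controlled := isControlled_diag.mono (by simp) }

/-- The adjoint matrix `(T*)_{x,y} = conj T_{y,x}`. -/
instance : Star (TranslationAlgebra X) where
  star T :=
    { entry := fun x y => star (T.entry y x)
      bounded := by
        obtain ⟨C, hC⟩ := T.bounded
        exact ⟨C, fun x y => by rw [norm_star]; exact hC y x⟩
      controlled := T.controlled.swap.mono (by simp) }

@[simp] theorem zero_entry (x y : X) : (0 : TranslationAlgebra X).entry x y = 0 := rfl
@[simp] theorem add_entry (T S : TranslationAlgebra X) (x y : X) :
    (T + S).entry x y = T.entry x y + S.entry x y := rfl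
@[simp] theorem neg_entry (T : TranslationAlgebra X) (x y : X) :
    (-T).entry x y = -T.entry x y := rfl
@[simp] theorem smul_entry (c : ℂ) (T : TranslationAlgebra X) (x y : X) :
    (c • T).entry x y = c * T.entry x y := rfl
@[simp] theorem star_entry (T : TranslationAlgebra X) (x y : X) :
    (star T).entry x y = star (T.entry y x) := rfl
open Classical in
@[simp] theorem one_entry (x y : X) :
    (1 : TranslationAlgebra X).entry x y = if x = y then 1 else 0 := rfl

variable [CoarseSpace X]

theorem exists_row_bound (T : TranslationAlgebra X) :
    ∃ N : ℕ, ∀ x : X, {y | T.entry x y ≠ 0}.encard ≤ N :=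
  T.controlled.row

theorem row_finite (T : TranslationAlgebra X) (x : X) : {y | T.entry x y ≠ 0}.Finite := by
  obtain ⟨N, hN⟩ := T.exists_row_bound
  exact Set.finite_of_encard_le_coe (hN x)

/-- The finite set of column indices of the nonzero entries of a row. -/
def row (T : TranslationAlgebra X) (x : X) : Finset X := (T.row_finite x).toFinset

theorem mem_row {T : TranslationAlgebra X} {x y : X} : y ∈ T.row x ↔ T.entry x y ≠ 0 := by
  simp [row]

theorem exists_row_card (T : TranslationAlgebra X) : ∃ N : ℕ, ∀ x : X, (T.row x).card ≤ N := by
  obtain ⟨N, hN⟩ := T.exists_row_bound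
  refine ⟨N, fun x => ?_⟩
  have := hN x
  rw [(T.row_finite x).encard_eq_coe_toFinset_card] at this
  exact_mod_cast this

theorem finsum_row (T S : TranslationAlgebra X) (x y : X) {s : Finset X} (hs : T.row x ⊆ s) :
    ∑ᶠ z, T.entry x z * S.entry z y = ∑ z ∈ s, T.entry x z * S.entry z y := by
  refine finsum_eq_sum_of_support_subset _ fun z hz => ?_
  exact hs (mem_row.2 (left_ne_zero_of_mul hz))

/-- The matrix product; all the sums are finite because `X` has bounded geometry. -/
instance : Mul (TranslationAlgebra X) where
  mul T S :=
    { entry := fun x y => ∑ᶠ z, T.entry x z * S.entry z y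
      bounded := by
        obtain ⟨C, hC⟩ := T.bounded
        obtain ⟨D, hD⟩ := S.bounded
        obtain ⟨N, hN⟩ := T.exists_row_card
        refine ⟨N * (C * D), fun x y => ?_⟩
        have hC0 : 0 ≤ C := (norm_nonneg _).trans (hC x y)
        have hD0 : 0 ≤ D := (norm_nonneg _).trans (hD x y)
        rw [finsum_row T S x y subset_rfl]
        calc ‖∑ z ∈ T.row x, T.entry x z * S.entry z y‖
            ≤ ∑ z ∈ T.row x, C * D := by
              refine norm_sum_le_of_le _ fun z _ => ?_
              rw [norm_mul]
              exact mul_le_mul (hC x z) (hD z y) (norm_nonneg _) hC0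
          _ = (T.row x).card * (C * D) := by simp
          _ ≤ N * (C * D) := by
              have : ((T.row x).card : ℝ) ≤ N := by exact_mod_cast hN x
              gcongr
      controlled := (T.controlled.comp S.controlled).mono (by
        intro p hp
        obtain ⟨z, hz⟩ := exists_ne_of_finsum hp
        exact ⟨z, left_ne_zero_of_mul hz, right_ne_zero_of_mul hz⟩) }

theorem mul_entry (T S : TranslationAlgebra X) (x y : X) :
    (T * S).entry x y = ∑ᶠ z, T.entry x z * S.entry z y := rfl

theorem mul_entry_sum (T S : TranslationAlgebra X) (x y : X) {s : Finset X} (hs : T.row x ⊆ s) :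
    (T * S).entry x y = ∑ z ∈ s, T.entry x z * S.entry z y :=
  finsum_row T S x y hs

open Classical in
instance : Ring (TranslationAlgebra X) where
  add_assoc _ _ _ := by ext; simp [add_assoc]
  zero_add _ := by ext; simp
  add_zero _ := by ext; simp
  add_comm _ _ := by ext; simp [add_comm]
  neg_add_cancel _ := by ext; simp
  nsmul := nsmulRec
  zsmul := zsmulRec
  left_distrib T S U := by
    ext x y
    simp only [mul_entry_sum T _ x y subset_rfl, add_entry, mul_add, Finset.sum_add_distrib]
  right_distrib T S U := by
    ext x y
    have h : (T + S).row x ⊆ T.row x ∪ S.row x := by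
      intro z hz
      rw [mem_row] at hz
      by_contra h
      simp only [Finset.mem_union, mem_row, not_or, not_not] at h
      exact hz (by simp [h])
    rw [add_entry, mul_entry_sum _ U x y h, mul_entry_sum T U x y (Finset.subset_union_left (s₂ := S.row x)),
      mul_entry_sum S U x y (Finset.subset_union_right (s₁ := T.row x))]
    simp only [add_entry, add_mul, Finset.sum_add_distrib]
  zero_mul T := by ext x y; simp [mul_entry]
  mul_zero T := by ext x y; simp [mul_entry]
  one_mul T := by
    ext x y
    rw [mul_entry_sum 1 T x y (s := {x}) (by intro z hz; rw [mem_row] at hz; simp at hz; simp [hz])]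
    simp
  mul_one T := by
    ext x y
    rw [mul_entry_sum T 1 x y subset_rfl]
    by_cases h : y ∈ T.row x
    · simp [h]
    · have : T.entry x y = 0 := by simpa [mem_row] using h
      simp [h, this]
  mul_assoc T S U := by
    ext x y
    have h : (T * S).row x ⊆ (T.row x).biUnion S.row := by
      intro z hz
      rw [mem_row] at hz
      obtain ⟨w, hw⟩ := exists_ne_of_finsum hz
      exact Finset.mem_biUnion.2 ⟨w, mem_row.2 (left_ne_zero_of_mul hw),
        mem_row.2 (right_ne_zero_of_mul hw)⟩
    rw [mul_entry_sum _ U x y h, mul_entry_sum T _ x y subset_rfl]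
    simp only [mul_entry_sum T S x _ subset_rfl, Finset.sum_mul]
    rw [Finset.sum_comm]
    refine Finset.sum_congr rfl fun w hw => ?_
    rw [mul_entry_sum S U w y (s := (T.row x).biUnion S.row)
      (Finset.subset_biUnion_of_mem S.row hw), Finset.mul_sum]
    exact Finset.sum_congr rfl fun z _ => mul_assoc _ _ _

instance : Module ℂ (TranslationAlgebra X) where
  one_smul _ := by ext; simp
  mul_smul _ _ _ := by ext; simp [mul_assoc]
  smul_zero _ := by ext; simp
  smul_add _ _ _ := by ext; simp [mul_add]
  add_smul _ _ _ := by ext; simp [add_mul]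
  zero_smul _ := by ext; simp

instance : Algebra ℂ (TranslationAlgebra X) :=
  Algebra.ofModule
    (fun c T S => by
      ext x y
      have h : (c • T).row x ⊆ T.row x := fun z hz => by
        rw [mem_row] at hz ⊢
        exact right_ne_zero_of_mul hz
      simp only [mul_entry_sum _ S x y h, smul_entry, mul_entry_sum T S x y subset_rfl,
        Finset.mul_sum, mul_assoc])
    (fun c T S => by
      ext x y
      simp only [smul_entry, mul_entry_sum T _ x y subset_rfl, Finset.mul_sum]
      exact Finset.sum_congr rfl fun z _ => by ring)

open Classical in
instance : StarRing (TranslationAlgebra X) where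
  star_involutive _ := by ext; simp
  star_add _ _ := by ext; simp
  star_mul T S := by
    ext x y
    rw [star_entry, mul_entry_sum T S y x (s := T.row y ∪ (star S).row x) Finset.subset_union_left,
      mul_entry_sum (star S) (star T) x y (s := T.row y ∪ (star S).row x)
        Finset.subset_union_right, star_sum]
    exact Finset.sum_congr rfl fun z _ => by simp [mul_comm]

instance : StarModule ℂ (TranslationAlgebra X) where
  star_smul _ _ := by ext; simp

end Algebra

/-! ## Representations and the maximal norm -/

/-- A representation of `ℂ_u[X]` on the Hilbert space `H`: a unital `*`-homomorphism into the
bounded operators on `H`. -/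
abbrev Rep (X : Type u) [EMetricSpace X] [CoarseSpace X] (H : Type u) [NormedAddCommGroup H]
    [InnerProductSpace ℂ H] [CompleteSpace H] :=
  TranslationAlgebra X →⋆ₐ[ℂ] (H →L[ℂ] H)

section Norm

variable {X : Type u} [EMetricSpace X] [CoarseSpace X]

/-- The norms `‖π(T)‖`, where `π` runs over all representations of `ℂ_u[X]`. Hilbert spaces are
taken in the universe of `X`; this is no restriction, since every representation is a direct sum
of cyclic ones and these live on Hilbert spaces of cardinality at most the continuum. -/
def repNorms (T : TranslationAlgebra X) : Set ℝ :=
  {r | ∃ (H : Type u) (_ : NormedAddCommGroup H) (_ : InnerProductSpace ℂ H) (_ : CompleteSpace H)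
    (π : Rep X H), r = ‖π T‖}

/-- The norm of the maximal uniform Roe algebra, the supremum of `‖π(T)‖` over all
representations. -/
def maxNorm (T : TranslationAlgebra X) : ℝ := sSup (repNorms T)

/-- If `T* T + G* G = B` then `‖π(T)‖ ≤ √B` in every representation. -/
theorem norm_rep_le_of_add_eq {T G : TranslationAlgebra X} {B : ℝ} (hB : 0 ≤ B)
    (h : star T * T + star G * G = (B : ℂ) • 1)
    {H : Type u} [NormedAddCommGroup H] [InnerProductSpace ℂ H] [CompleteSpace H]
    (π : Rep X H) : ‖π T‖ ≤ √B := by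
  refine ContinuousLinearMap.opNorm_le_bound _ (Real.sqrt_nonneg B) fun ξ => ?_
  have key : ∀ S : TranslationAlgebra X, inner ℂ ξ (π (star S * S) ξ) = (‖π S ξ‖ : ℂ) ^ 2 := by
    intro S
    rw [map_mul, map_star, ContinuousLinearMap.star_eq_adjoint, mul_apply_eq_comp,
      ContinuousLinearMap.adjoint_inner_right, inner_self_eq_norm_sq_to_K]
    rfl
  have h1 := congrArg (fun S => inner ℂ ξ (π S ξ)) h
  simp only [map_add, add_apply, inner_add_right, key, map_smul, map_one,
    smul_apply, one_apply_eq_self, inner_smul_right,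
    inner_self_eq_norm_sq_to_K] at h1
  have h2 : ‖π T ξ‖ ^ 2 + ‖π G ξ‖ ^ 2 = B * ‖ξ‖ ^ 2 := by
    apply Complex.ofReal_injective
    push_cast
    exact h1
  refine le_of_sq_le_sq ?_ (by positivity)
  rw [mul_pow, Real.sq_sqrt hB]
  nlinarith [sq_nonneg ‖π G ξ‖]

/-- A bounded diagonal matrix. -/
def diag (g : X → ℝ) (C : ℝ) (hg : ∀ x, |g x| ≤ C) : TranslationAlgebra X :=
  open Classical in
  { entry := fun x y => if x = y then (g x : ℂ) else 0
    bounded := ⟨C, fun x y => by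
      split_ifs
      · simpa using hg x
      · simpa using (abs_nonneg _).trans (hg x)⟩
    controlled := isControlled_diag.mono (by
      intro p hp
      by_contra h
      exact hp (if_neg h)) }

open Classical in
theorem exists_add_eq (S : TranslationAlgebra X)
    (h : ∀ x y z, S.entry x y ≠ 0 → S.entry x z ≠ 0 → y = z) :
    ∃ (G : TranslationAlgebra X) (B : ℝ), 0 ≤ B ∧ star S * S + star G * G = (B : ℂ) • 1 := by
  obtain ⟨N, hN⟩ := (star S).exists_row_card
  obtain ⟨C, hC⟩ := S.bounded
  set d : X → ℝ := fun y => ∑ x ∈ (star S).row y, ‖S.entry x y‖ ^ 2 with hd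
  have hd0 : ∀ y, 0 ≤ d y := fun y => Finset.sum_nonneg fun _ _ => sq_nonneg _
  have hdB : ∀ y, d y ≤ N * C ^ 2 := by
    intro y
    calc d y ≤ ∑ x ∈ (star S).row y, C ^ 2 :=
          Finset.sum_le_sum fun x _ => pow_le_pow_left₀ (norm_nonneg _) (hC x y) 2
      _ = ((star S).row y).card * C ^ 2 := by simp
      _ ≤ N * C ^ 2 := by
          have : (((star S).row y).card : ℝ) ≤ N := by exact_mod_cast hN y
          gcongr
  refine ⟨diag (fun y => √(N * C ^ 2 - d y)) (√(N * C ^ 2)) fun y => ?_, N * C ^ 2,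
    by positivity, ?_⟩
  · rw [abs_of_nonneg (Real.sqrt_nonneg _)]
    exact Real.sqrt_le_sqrt (by linarith [hd0 y])
  · ext y z
    set G := diag (X := X) (fun y => √(N * C ^ 2 - d y)) (√(N * C ^ 2)) _ with hG
    have hGe : ∀ a b, G.entry a b = if a = b then ((√(N * C ^ 2 - d a) : ℝ) : ℂ) else 0 :=
      fun a b => rfl
    have hr : (star G).row y ⊆ {y} := by
      intro w hw
      rw [mem_row, star_entry, hGe] at hw
      by_contra hwy
      rw [Finset.mem_singleton] at hwy
      exact hw (by simp [hwy])
    rw [add_entry, mul_entry_sum _ _ y z subset_rfl, mul_entry_sum _ _ y z hr,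
      Finset.sum_singleton, smul_entry, one_entry]
    simp only [star_entry, hGe]
    by_cases hyz : y = z
    · subst hyz
      have e1 : ∀ x, star (S.entry x y) * S.entry x y = ((‖S.entry x y‖ ^ 2 : ℝ) : ℂ) := by
        intro x
        rw [Complex.star_def, Complex.conj_mul']
        push_cast
        rfl
      have e2 : star ((√(N * C ^ 2 - d y) : ℝ) : ℂ) * ((√(N * C ^ 2 - d y) : ℝ) : ℂ)
          = ((N * C ^ 2 - d y : ℝ) : ℂ) := by
        rw [Complex.star_def, Complex.conj_ofReal, ← Complex.ofReal_mul,
          Real.mul_self_sqrt (by linarith [hdB y])]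
      simp only [e1, if_true, e2]
      rw [← Complex.ofReal_sum, ← Complex.ofReal_add, mul_one, Complex.ofReal_inj]
      change d y + _ = _
      ring
    · simp only [hyz, if_false, mul_zero, add_zero]
      refine Finset.sum_eq_zero fun x _ => ?_
      by_contra hne
      have h1 := left_ne_zero_of_mul hne
      have h2 := right_ne_zero_of_mul hne
      exact hyz (h x y z (by simpa using h1) h2)

open Classical in
/-- The position of `y` in an enumeration of the row `x` of `T`. -/
def rowIndex (T : TranslationAlgebra X) (x y : X) : ℕ :=
  if h : y ∈ T.row x then ((T.row x).equivFin ⟨y, h⟩ : ℕ) else 0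

open Classical in
/-- The matrix which keeps only the `i`-th nonzero entry of each row of `T`. -/
def piece (T : TranslationAlgebra X) (i : ℕ) : TranslationAlgebra X where
  entry x y := if T.rowIndex x y = i then T.entry x y else 0
  bounded := by
    obtain ⟨C, hC⟩ := T.bounded
    refine ⟨C, fun x y => ?_⟩
    split_ifs
    · exact hC x y
    · simpa using (norm_nonneg _).trans (hC x y)
  controlled := T.controlled.mono fun p hp h => hp (by simp only [h, ite_self])

theorem piece_row (T : TranslationAlgebra X) (i : ℕ) (x y z : X)
    (hy : (T.piece i).entry x y ≠ 0) (hz : (T.piece i).entry x z ≠ 0) : y = z := by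
  simp only [piece, ne_eq, ite_eq_right_iff, Classical.not_imp] at hy hz
  have my := mem_row.2 hy.2
  have mz := mem_row.2 hz.2
  have := hy.1.trans hz.1.symm
  simp only [rowIndex, my, mz, dif_pos] at this
  simpa using (T.row x).equivFin.injective (Fin.ext this)

theorem sum_entry {ι : Type*} (s : Finset ι) (f : ι → TranslationAlgebra X) (x y : X) :
    (∑ i ∈ s, f i).entry x y = ∑ i ∈ s, (f i).entry x y := by
  classical
  induction s using Finset.induction_on with
  | empty => simp
  | insert a s ha ih => simp [Finset.sum_insert ha, ih]

theorem exists_sum_piece (T : TranslationAlgebra X) :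
    ∃ N : ℕ, T = ∑ i ∈ Finset.range N, T.piece i := by
  classical
  obtain ⟨N, hN⟩ := T.exists_row_card
  refine ⟨N, ?_⟩
  ext x y
  rw [sum_entry]
  simp only [piece]
  by_cases h : T.entry x y = 0
  · simp [h]
  · have hm := mem_row.2 h
    have hlt : T.rowIndex x y < N := by
      simp only [rowIndex, hm, dif_pos]
      exact lt_of_lt_of_le (Fin.is_lt _) (hN x)
    rw [Finset.sum_ite_eq, if_pos (Finset.mem_range.2 hlt)]

theorem bddAbove_repNorms (T : TranslationAlgebra X) : BddAbove (repNorms T) := by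
  obtain ⟨N, hN⟩ := T.exists_sum_piece
  choose G B hB h using fun i => exists_add_eq (T.piece i) (T.piece_row i)
  refine ⟨∑ i ∈ Finset.range N, √(B i), ?_⟩
  rintro _ ⟨H, _, _, _, π, rfl⟩
  calc ‖π T‖ = ‖∑ i ∈ Finset.range N, π (T.piece i)‖ := by rw [← map_sum, ← hN]
    _ ≤ _ := norm_sum_le_of_le _ fun i _ => norm_rep_le_of_add_eq (hB i) (h i) π

theorem norm_rep_le (T : TranslationAlgebra X) {H : Type u} [NormedAddCommGroup H]
    [InnerProductSpace ℂ H] [CompleteSpace H] (π : Rep X H) : ‖π T‖ ≤ maxNorm T :=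
  le_csSup T.bddAbove_repNorms ⟨H, _, _, _, π, rfl⟩

theorem maxNorm_le {T : TranslationAlgebra X} {c : ℝ} (hc : 0 ≤ c)
    (h : ∀ (H : Type u) [NormedAddCommGroup H] [InnerProductSpace ℂ H] [CompleteSpace H]
      (π : Rep X H), ‖π T‖ ≤ c) : maxNorm T ≤ c := by
  refine Real.sSup_le ?_ hc
  rintro _ ⟨H, _, _, _, π, rfl⟩
  exact h H π

theorem maxNorm_nonneg (T : TranslationAlgebra X) : 0 ≤ maxNorm T := by
  refine Real.sSup_nonneg ?_
  rintro _ ⟨H, _, _, _, π, rfl⟩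
  exact norm_nonneg _

/-- `ℂ_u[X]` with the maximal norm. -/
instance : SeminormedRing (TranslationAlgebra X) :=
  RingSeminorm.toSeminormedRing
    { toFun := maxNorm
      map_zero' := le_antisymm (maxNorm_le le_rfl fun H _ _ _ π => by simp) (maxNorm_nonneg _)
      add_le' := fun T S => maxNorm_le (add_nonneg (maxNorm_nonneg _) (maxNorm_nonneg _))
        fun H _ _ _ π => by
          rw [map_add]
          exact (norm_add_le _ _).trans (add_le_add (norm_rep_le T π) (norm_rep_le S π))
      neg' := fun T => le_antisymm
        (maxNorm_le (maxNorm_nonneg _) fun H _ _ _ π => by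
          rw [map_neg, norm_neg]; exact norm_rep_le T π)
        (maxNorm_le (maxNorm_nonneg _) fun H _ _ _ π => by
          rw [← norm_neg, ← map_neg]; exact norm_rep_le _ π)
      mul_le' := fun T S => maxNorm_le (mul_nonneg (maxNorm_nonneg _) (maxNorm_nonneg _))
        fun H _ _ _ π => by
          rw [map_mul]
          exact (norm_mul_le _ _).trans (mul_le_mul (norm_rep_le T π) (norm_rep_le S π)
            (norm_nonneg _) (maxNorm_nonneg _)) }

theorem norm_def (T : TranslationAlgebra X) : ‖T‖ = maxNorm T := rfl

instance : NormedAlgebra ℂ (TranslationAlgebra X) where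
  norm_smul_le c T := maxNorm_le (mul_nonneg (norm_nonneg _) (maxNorm_nonneg _))
    fun H _ _ _ π => by
      rw [map_smul, norm_smul]
      exact mul_le_mul_of_nonneg_left (norm_rep_le T π) (norm_nonneg _)

instance : NormedStarGroup (TranslationAlgebra X) where
  norm_star_le T := maxNorm_le (maxNorm_nonneg _) fun H _ _ _ π => by
    rw [map_star, norm_star]
    exact norm_rep_le T π

theorem norm_mul_self_le (T : TranslationAlgebra X) : ‖T‖ * ‖T‖ ≤ ‖star T * T‖ := by
  have h : maxNorm T ≤ √(maxNorm (star T * T)) :=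
    maxNorm_le (Real.sqrt_nonneg _) fun H _ _ _ π => by
      refine Real.le_sqrt_of_sq_le ?_
      rw [sq, ← CStarRing.norm_star_mul_self, ← map_star, ← map_mul]
      exact norm_rep_le _ π
  calc ‖T‖ * ‖T‖ ≤ √(maxNorm (star T * T)) * √(maxNorm (star T * T)) :=
        mul_self_le_mul_self (norm_nonneg _) h
    _ = _ := Real.mul_self_sqrt (maxNorm_nonneg _)

end Norm

end TranslationAlgebra

/-! ## The maximal uniform Roe algebra -/

open UniformSpace

/-- The maximal uniform Roe algebra `C*_{u,max}(X)`: the completion of `ℂ_u[X]` for the maximal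
norm. -/
abbrev MaxRoe (X : Type u) [EMetricSpace X] [CoarseSpace X] : Type u :=
  Completion (TranslationAlgebra X)

section MaxRoe

variable {X : Type u} [EMetricSpace X] [CoarseSpace X]

/-- The involution, extended by continuity. -/
instance : Star (MaxRoe X) := ⟨Completion.map star⟩

theorem continuous_star_maxRoe : Continuous (star : MaxRoe X → MaxRoe X) :=
  Completion.continuous_map

theorem coe_star (T : TranslationAlgebra X) : ((star T : TranslationAlgebra X) : MaxRoe X) =
    star (T : MaxRoe X) :=
  (Completion.map_coe (starNormedAddGroupHom (E := TranslationAlgebra X)).uniformContinuous T).symm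

instance : StarRing (MaxRoe X) where
  star_involutive a := by
    induction a using Completion.induction_on with
    | hp => exact isClosed_eq (continuous_star_maxRoe.comp continuous_star_maxRoe) continuous_id
    | ih T => rw [← coe_star, ← coe_star, star_star]
  star_add a b := by
    induction a, b using Completion.induction_on₂ with
    | hp =>
      have := continuous_star_maxRoe (X := X)
      exact isClosed_eq (by fun_prop) (by fun_prop)
    | ih T S => simp only [← coe_star, ← Completion.coe_add, star_add]
  star_mul a b := by
    induction a, b using Completion.induction_on₂ with
    | hp =>
      have := continuous_star_maxRoe (X := X)
      exact isClosed_eq (by fun_prop) (by fun_prop)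
    | ih T S => simp only [← coe_star, ← Completion.coe_mul, star_mul]

instance : NormedAlgebra ℂ (MaxRoe X) :=
  { (Completion.algebra (TranslationAlgebra X) ℂ : Algebra ℂ (MaxRoe X)) with
    norm_smul_le := fun c a => norm_smul_le c a }

instance : StarModule ℂ (MaxRoe X) where
  star_smul c a := by
    induction a using Completion.induction_on with
    | hp =>
      have h := continuous_star_maxRoe (X := X)
      exact isClosed_eq (h.comp (continuous_const_smul c)) (h.const_smul (star c))
    | ih T => rw [← Completion.coe_smul, ← coe_star, ← coe_star, star_smul, Completion.coe_smul]

instance : CStarRing (MaxRoe X) where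
  norm_mul_self_le a := by
    induction a using Completion.induction_on with
    | hp =>
      have := continuous_star_maxRoe (X := X)
      exact isClosed_le (by fun_prop) (by fun_prop)
    | ih T =>
      rw [← coe_star, ← Completion.coe_mul, Completion.norm_coe, Completion.norm_coe]
      exact T.norm_mul_self_le

/-- `C*_{u,max}(X)` is a unital C*-algebra. -/
instance : CStarAlgebra (MaxRoe X) where

/-- The unique continuous extension to `C*_{u,max}(X)` of a contractive unital `*`-homomorphism
from `ℂ_u[X]` to a C*-algebra. -/
def extend {B : Type*} [NormedRing B] [StarRing B] [NormedAlgebra ℂ B]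
    [CStarRing B] [CompleteSpace B] (φ : TranslationAlgebra X →⋆ₐ[ℂ] B)
    (hφ : ∀ T, ‖φ T‖ ≤ ‖T‖) : MaxRoe X →⋆ₐ[ℂ] B :=
  have hu : UniformContinuous φ :=
    (LipschitzWith.of_dist_le_mul (K := 1) fun T S => by
      rw [dist_eq_norm, dist_eq_norm, ← map_sub, NNReal.coe_one, one_mul]
      exact hφ _).uniformContinuous
  { toFun := Completion.extension φ
    map_one' := by rw [← Completion.coe_one, Completion.extension_coe hu, map_one]
    map_mul' := fun a b => by
      induction a, b using Completion.induction_on₂ with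
      | hp =>
        have := Completion.continuous_extension (f := φ)
        exact isClosed_eq (by fun_prop) (by fun_prop)
      | ih T S => simp only [← Completion.coe_mul, Completion.extension_coe hu, map_mul]
    map_zero' := by rw [← Completion.coe_zero, Completion.extension_coe hu, map_zero]
    map_add' := fun a b => by
      induction a, b using Completion.induction_on₂ with
      | hp =>
        have := Completion.continuous_extension (f := φ)
        exact isClosed_eq (by fun_prop) (by fun_prop)
      | ih T S => simp only [← Completion.coe_add, Completion.extension_coe hu, map_add]
    commutes' := fun c => by
      rw [Completion.algebraMap_def, Completion.extension_coe hu]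
      exact AlgHomClass.commutes φ c
    map_star' := fun a => by
      induction a using Completion.induction_on with
      | hp =>
        have := Completion.continuous_extension (f := φ)
        have := continuous_star_maxRoe (X := X)
        exact isClosed_eq (by fun_prop) (by fun_prop)
      | ih T => rw [← coe_star, Completion.extension_coe hu, Completion.extension_coe hu, map_star] }

theorem extend_coe {B : Type*} [NormedRing B] [StarRing B] [NormedAlgebra ℂ B]
    [CStarRing B] [CompleteSpace B] (φ : TranslationAlgebra X →⋆ₐ[ℂ] B)
    (hφ : ∀ T, ‖φ T‖ ≤ ‖T‖) (T : TranslationAlgebra X) : extend φ hφ (T : MaxRoe X) = φ T :=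
  Completion.extension_coe (LipschitzWith.of_dist_le_mul (K := 1) fun T S => by
      rw [dist_eq_norm, dist_eq_norm, ← map_sub, NNReal.coe_one, one_mul]
      exact hφ _).uniformContinuous T

/-- The extension of a representation of `ℂ_u[X]` to `C*_{u,max}(X)`. -/
def extendRep {H : Type u} [NormedAddCommGroup H] [InnerProductSpace ℂ H] [CompleteSpace H]
    (π : TranslationAlgebra.Rep X H) : MaxRoe X →⋆ₐ[ℂ] (H →L[ℂ] H) :=
  extend π fun T => T.norm_rep_le π

end MaxRoe

/-! ## Partial translations, invariant vectors, Property (T) -/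

section PropertyT

/-- A partial translation: a bijection `t : A → B` between subsets of `X` (a partial equivalence)
whose graph `{(x, y) | x = t(y)}` is controlled. -/
structure PartialTranslation (X : Type u) [EMetricSpace X] where
  toPEquiv : X ≃. X
  controlled_graph : IsControlled {p : X × X | toPEquiv p.2 = some p.1}

variable {X : Type u} [EMetricSpace X]

open Classical in
/-- The matrix of a partial translation: `v_{x,y} = 1` if `t(y) = x`, and `0` otherwise. -/
def PartialTranslation.matrix (t : PartialTranslation X) : TranslationAlgebra X where
  entry x y := if t.toPEquiv y = some x then 1 else 0
  bounded := ⟨1, fun x y => by split_ifs <;> simp⟩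
  controlled := t.controlled_graph.mono fun p hp => by
    by_contra h
    exact hp (if_neg h)

variable [CoarseSpace X]

/-- The subspace of invariant vectors of a representation: those `ξ` with `π(v) ξ = π(v v*) ξ` for
every partial translation `v`. -/
def invariants {H : Type u} [NormedAddCommGroup H] [InnerProductSpace ℂ H] [CompleteSpace H]
    (π : TranslationAlgebra.Rep X H) : Submodule ℂ H where
  carrier := {ξ | ∀ t : PartialTranslation X,
    π t.matrix ξ = π (t.matrix * star t.matrix) ξ}
  add_mem' := fun ha hb t => by rw [map_add, map_add, ha t, hb t]
  zero_mem' := fun t => by rw [map_zero, map_zero]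
  smul_mem' := fun c ξ h t => by rw [map_smul, map_smul, h t]

theorem isClosed_invariants {H : Type u} [NormedAddCommGroup H] [InnerProductSpace ℂ H]
    [CompleteSpace H] (π : TranslationAlgebra.Rep X H) :
    IsClosed (invariants π : Set H) := by
  have : (invariants π : Set H) = ⋂ t : PartialTranslation X,
      {ξ | π t.matrix ξ = π (t.matrix * star t.matrix) ξ} := by
    ext ξ
    rw [Set.mem_iInter]
    rfl
  rw [this]
  exact isClosed_iInter fun t => isClosed_eq (ContinuousLinearMap.continuous _)
    (ContinuousLinearMap.continuous _)

instance {H : Type u} [NormedAddCommGroup H] [InnerProductSpace ℂ H]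
    [CompleteSpace H] (π : TranslationAlgebra.Rep X H) : CompleteSpace (invariants π) :=
  (isClosed_invariants π).completeSpace_coe

/-- Geometric Property (T) of the space `X`. -/
def HasPropertyT (X : Type u) [EMetricSpace X] [CoarseSpace X] : Prop :=
  ∀ E : Set (X × X), IsControlledGenerating E → ∃ c : ℝ, 0 < c ∧
    ∀ (H : Type u) [NormedAddCommGroup H] [InnerProductSpace ℂ H] [CompleteSpace H]
      (π : TranslationAlgebra.Rep X H), ∀ ξ ∈ (invariants π)ᗮ,
        ∃ t : PartialTranslation X, t.matrix.supp ⊆ E ∧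
          c * ‖ξ‖ ≤ ‖(π t.matrix - π (t.matrix * star t.matrix)) ξ‖

/-- `P` is the Kazhdan projection of `C*_{u,max}(X)`: it is a projection whose image under every
representation is the orthogonal projection onto the subspace of invariant vectors. -/
def IsKazhdanProjection (P : MaxRoe X) : Prop :=
  IsStarProjection P ∧
    ∀ (H : Type u) [NormedAddCommGroup H] [InnerProductSpace ℂ H] [CompleteSpace H]
      (π : TranslationAlgebra.Rep X H), extendRep π P = (invariants π).starProjection

end PropertyT

/-! ## Restriction to a coarse component -/

section Restriction

variable {X : Type u} [EMetricSpace X] [CoarseSpace X]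

/-- The diagonal projection `𝟙_{X_n}` in `ℂ_u[X]`. -/
def componentProj (n : Components X) : TranslationAlgebra X :=
  open Classical in
  { entry := fun x y => if x = y ∧ (Quotient.mk _ x : Components X) = n then 1 else 0
    bounded := ⟨1, fun x y => by split_ifs <;> simp⟩
    controlled := isControlled_diag.mono fun p hp => by
      by_contra h
      exact hp (if_neg fun h' => h h'.1) }

theorem TranslationAlgebra.edist_lt (T : TranslationAlgebra X) {x y : X}
    (h : T.entry x y ≠ 0) : edist x y < ⊤ := by
  obtain ⟨R, -, hR⟩ := T.controlled
  exact lt_of_le_of_lt (hR (a := (x, y)) h) ENNReal.coe_lt_top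

theorem finsum_eq_finsum_component (n : Components X) (T S : TranslationAlgebra X)
    (x y : Component X n) :
    ∑ᶠ z : Component X n, T.entry x z * S.entry z y = ∑ᶠ z : X, T.entry x z * S.entry z y := by
  rw [finsum_subtype_eq_finsum_cond (f := fun z : X => T.entry x z * S.entry z y)
    (fun z : X => (Quotient.mk _ z : Components X) = n)]
  refine finsum_congr fun z => ?_
  by_cases hz : (Quotient.mk _ z : Components X) = n
  · simp [hz]
  · have h0 : T.entry x z = 0 := by
      by_contra h
      exact hz (mem_component_of_edist_lt x (T.edist_lt h))
    simp [h0]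

/-- The restriction map `Q_n : ℂ_u[X] → ℂ_u[X_n]`, as a unital `*`-homomorphism. -/
def restrict (n : Components X) :
    TranslationAlgebra X →⋆ₐ[ℂ] TranslationAlgebra (Component X n) where
  toFun T :=
    { entry := fun x y => T.entry x y
      bounded := by
        obtain ⟨C, hC⟩ := T.bounded
        exact ⟨C, fun x y => hC x y⟩
      controlled := by
        obtain ⟨R, h0, hR⟩ := T.controlled
        exact ⟨R, h0, fun p (hp : T.entry p.1 p.2 ≠ 0) =>
          hR (a := ((p.1 : X), (p.2 : X))) hp⟩ }
  map_one' := by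
    classical
    ext x y
    simp [Subtype.ext_iff]
  map_mul' T S := by
    ext x y
    simp only [TranslationAlgebra.mul_entry]
    exact (finsum_eq_finsum_component n T S x y).symm
  map_zero' := rfl
  map_add' _ _ := rfl
  commutes' c := by
    classical
    ext x y
    simp [Algebra.algebraMap_eq_smul_one, Subtype.ext_iff]
  map_star' _ := rfl

/-- `Q_n(T)` is the block of `T 𝟙_{X_n}` indexed by `X_n`, and all the entries of `T 𝟙_{X_n}`
outside this block vanish. -/
theorem mul_componentProj_entry (n : Components X) (T : TranslationAlgebra X) :
    (∀ x y : Component X n, (T * componentProj n).entry x y = (restrict n T).entry x y) ∧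
    (∀ x y : X, (T * componentProj n).entry x y ≠ 0 →
      (Quotient.mk _ x : Components X) = n ∧ (Quotient.mk _ y : Components X) = n) := by
  classical
  have key : ∀ x y : X, (T * componentProj n).entry x y =
      if (Quotient.mk _ y : Components X) = n then T.entry x y else 0 := by
    intro x y
    rw [TranslationAlgebra.mul_entry, finsum_eq_single _ y fun z hz => ?_]
    · simp [componentProj]
    · simp [componentProj, hz]
  refine ⟨fun x y => (key x y).trans (if_pos y.2), fun x y h => ?_⟩
  rw [key, ne_eq, ite_eq_right_iff, Classical.not_imp] at h
  exact ⟨mem_component_of_edist_lt ⟨y, h.1⟩ (edist_comm x y ▸ T.edist_lt h.2), h.1⟩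

theorem norm_restrict_le (n : Components X) (T : TranslationAlgebra X) :
    ‖restrict n T‖ ≤ ‖T‖ :=
  TranslationAlgebra.maxNorm_le (norm_nonneg _) fun _ _ _ _ π => T.norm_rep_le (π.comp (restrict n))

/-- The inclusion of `ℂ_u[X]` into `C*_{u,max}(X)`. -/
def toMaxRoe (X : Type u) [EMetricSpace X] [CoarseSpace X] :
    TranslationAlgebra X →⋆ₐ[ℂ] MaxRoe X where
  toFun T := (T : MaxRoe X)
  map_one' := Completion.coe_one _
  map_mul' := Completion.coe_mul
  map_zero' := Completion.coe_zero
  map_add' := Completion.coe_add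
  commutes' _ := rfl
  map_star' := coe_star

/-- The extension `Q_n : C*_{u,max}(X) → C*_{u,max}(X_n)` of the restriction map. -/
def restrictMax (n : Components X) : MaxRoe X →⋆ₐ[ℂ] MaxRoe (Component X n) :=
  extend ((toMaxRoe (Component X n)).comp (restrict n)) fun T =>
    (Completion.norm_coe _).trans_le (norm_restrict_le n T)

end Restriction

end Coarse

end

/-!
A vector `ξ` is invariant when it is killed by all the *defects* `v - v v*` of partial translations.

*Existence.* A controlled generating set `E` is a finite disjoint union of graphs of partial
translations `v i`, and the defect of any partial translation supported in `E` is a combination of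
the defects `Dᵢ` of the `v i`, with projections as coefficients (`PartialTranslation.defect_eq_sum`).
So Property (T) bounds `∑ ‖π(Dᵢ) ξ‖` from below on the orthogonal complement of the invariant
vectors, and `1 - s ∑ Dᵢ* Dᵢ`, for small `s > 0`, fixes the invariant vectors and contracts their
complement by a factor independent of the representation (`HasPropertyT.exists_contraction`). Since
the maximal norm is a supremum over representations, the powers of this element converge in
`C*_{u,max}(X)`, and the limit is a Kazhdan projection. It is unique because representations
separate points (`eq_of_extendRep_eq`).

*Components.* Representations of `ℂ_u[X_n]` are representations of `ℂ_u[X]` through the restriction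
map, with the same invariant vectors (`invariants_comp_restrict`). Moreover a controlled generating
set of `X_n` can be completed to one of `X`. Hence Property (T) and Kazhdan projections restrict
to `X_n`.

*Entries.* By uniqueness it is enough to exhibit the Kazhdan projection of `X_n`. If `X_n` is finite,
the matrix with all entries `1 / |X_n|` is one (`rep_meanMatrix`). If `X_n` is infinite, `0` is one,
that is, no representation has nonzero invariant vectors (`HasPropertyT.invariants_eq_bot`). Indeed
the regular representation on `ℓ²(X_n)` has none, since they would be constant; therefore Property
(T), applied to indicator functions of finite sets, is an isoperimetric inequality
(`HasPropertyT.exists_expansion`), and after iteration all finite sets are doubled by a neighborhood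
of fixed radius. Hall's marriage theorem then provides two isometries in `ℂ_u[X_n]` with orthogonal
ranges which come from partial translations (`exists_paradoxical`). Each of them fixes every
invariant vector, in any representation, so such a vector is `0`.
-/

namespace Coarse

open TranslationAlgebra UniformSpace PartialTranslation

/-! ### Partial translations and their graphs -/

namespace PartialTranslation

section

variable {X : Type u} [EMetricSpace X]

/-- The graph `{(x, y) | x = t(y)}` of a partial translation. As a set of pairs it is the support of
the matrix of `t`, hence the order of the coordinates. -/
def graph (t : PartialTranslation X) : Set (X × X) := {p | t.toPEquiv p.2 = some p.1}

theorem mem_graph {t : PartialTranslation X} {x y : X} :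
    (x, y) ∈ t.graph ↔ t.toPEquiv y = some x := Iff.rfl

open Classical in
theorem matrix_entry (t : PartialTranslation X) (x y : X) :
    t.matrix.entry x y = if (x, y) ∈ t.graph then 1 else 0 :=
  if_congr mem_graph.symm rfl rfl

theorem supp_matrix (t : PartialTranslation X) : t.matrix.supp = t.graph := by
  ext ⟨x, y⟩
  simp [supp, matrix_entry]

theorem graph_row (t : PartialTranslation X) {x y z : X} (hy : (x, y) ∈ t.graph)
    (hz : (x, z) ∈ t.graph) : y = z :=
  t.toPEquiv.inj hy hz

theorem graph_col (t : PartialTranslation X) {x y z : X} (hx : (x, z) ∈ t.graph)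
    (hy : (y, z) ∈ t.graph) : x = y :=
  Option.some_injective _ (hx.symm.trans hy)

open Classical in
/-- The partial translation with a prescribed graph: a controlled set with at most one point in each
row and in each column. -/
noncomputable def ofGraph (G : Set (X × X)) (hG : IsControlled G)
    (hrow : ∀ x y z, (x, y) ∈ G → (x, z) ∈ G → y = z)
    (hcol : ∀ x y z, (x, z) ∈ G → (y, z) ∈ G → x = y) : PartialTranslation X :=
  have h₁ : ∀ x y, (if h : ∃ x, (x, y) ∈ G then some h.choose else none) = some x ↔
      (x, y) ∈ G := by
    intro x y
    constructor
    · intro h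
      split_ifs at h with h'
      rw [← Option.some_injective _ h]
      exact h'.choose_spec
    · intro h
      have h' : ∃ x, (x, y) ∈ G := ⟨x, h⟩
      rw [dif_pos h', hcol _ _ _ h'.choose_spec h]
  have h₂ : ∀ x y, (if h : ∃ y, (x, y) ∈ G then some h.choose else none) = some y ↔
      (x, y) ∈ G := by
    intro x y
    constructor
    · intro h
      split_ifs at h with h'
      rw [← Option.some_injective _ h]
      exact h'.choose_spec
    · intro h
      have h' : ∃ y, (x, y) ∈ G := ⟨y, h⟩
      rw [dif_pos h', hrow _ _ _ h'.choose_spec h]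
  { toPEquiv :=
      { toFun := fun y => if h : ∃ x, (x, y) ∈ G then some h.choose else none
        invFun := fun x => if h : ∃ y, (x, y) ∈ G then some h.choose else none
        inv := fun y x => (h₂ x y).trans (h₁ x y).symm }
    controlled_graph := hG.mono fun p hp => (h₁ p.1 p.2).1 hp }

@[simp] theorem graph_ofGraph (G : Set (X × X)) (hG : IsControlled G)
    (hrow : ∀ x y z, (x, y) ∈ G → (x, z) ∈ G → y = z)
    (hcol : ∀ x y z, (x, z) ∈ G → (y, z) ∈ G → x = y) : (ofGraph G hG hrow hcol).graph = G := by
  classical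
  ext ⟨x, y⟩
  change (if h : ∃ x, (x, y) ∈ G then some h.choose else none) = some x ↔ _
  constructor
  · intro h
    split_ifs at h with h'
    rw [← Option.some_injective _ h]
    exact h'.choose_spec
  · intro h
    have h' : ∃ x, (x, y) ∈ G := ⟨x, h⟩
    rw [dif_pos h', hcol _ _ _ h'.choose_spec h]

/-- The restriction of a partial translation to a part of its graph. -/
noncomputable def inter (t : PartialTranslation X) (G : Set (X × X)) : PartialTranslation X :=
  ofGraph (t.graph ∩ G) (t.controlled_graph.mono Set.inter_subset_left)
    (fun _ _ _ h h' => t.graph_row h.1 h'.1) (fun _ _ _ h h' => t.graph_col h.1 h'.1)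

@[simp] theorem graph_inter (t : PartialTranslation X) (G : Set (X × X)) :
    (t.inter G).graph = t.graph ∩ G := graph_ofGraph ..

/-- The inverse partial translation. -/
noncomputable def symm (t : PartialTranslation X) : PartialTranslation X :=
  ofGraph {p | (p.2, p.1) ∈ t.graph} (IsControlled.swap t.controlled_graph)
    (fun _ _ _ h h' => t.graph_col h h') (fun _ _ _ h h' => t.graph_row h h')

@[simp] theorem mem_graph_symm {t : PartialTranslation X} {x y : X} :
    (x, y) ∈ t.symm.graph ↔ (y, x) ∈ t.graph := by
  rw [symm, graph_ofGraph]
  rfl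

theorem matrix_symm (t : PartialTranslation X) : t.symm.matrix = star t.matrix := by
  classical
  ext x y
  simp [matrix_entry, apply_ite]

end

variable {X : Type u} [EMetricSpace X] [CoarseSpace X]

theorem matrix_mul_entry_of_mem (t : PartialTranslation X) (T : TranslationAlgebra X) {x z : X}
    (h : (x, z) ∈ t.graph) (y : X) : (t.matrix * T).entry x y = T.entry z y := by
  classical
  rw [mul_entry, finsum_eq_single _ z, matrix_entry, if_pos h, one_mul]
  intro w hw
  rw [matrix_entry, if_neg fun h' => hw (t.graph_row h' h), zero_mul]

theorem matrix_mul_entry_of_forall_notMem (t : PartialTranslation X) (T : TranslationAlgebra X)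
    {x : X} (h : ∀ z, (x, z) ∉ t.graph) (y : X) : (t.matrix * T).entry x y = 0 := by
  classical
  rw [mul_entry]
  refine finsum_eq_zero_of_forall_eq_zero fun z => ?_
  rw [matrix_entry, if_neg (h z), zero_mul]

open Classical in
/-- Left multiplication by `v v*` keeps the rows with index in the range of the partial translation,
and deletes the others. -/
theorem matrix_mul_star_mul_entry (t : PartialTranslation X) (T : TranslationAlgebra X) (x y : X) :
    (t.matrix * star t.matrix * T).entry x y =
      if ∃ z, (x, z) ∈ t.graph then T.entry x y else 0 := by
  rw [mul_assoc]
  split_ifs with h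
  · obtain ⟨z, hz⟩ := h
    have hz' : (z, x) ∈ t.symm.graph := mem_graph_symm.2 hz
    rw [matrix_mul_entry_of_mem t _ hz, ← matrix_symm, matrix_mul_entry_of_mem _ _ hz']
  · exact matrix_mul_entry_of_forall_notMem t _ (not_exists.1 h) y

open Classical in
theorem matrix_mul_star_entry (t : PartialTranslation X) (x y : X) :
    (t.matrix * star t.matrix).entry x y =
      if ∃ z, (x, z) ∈ t.graph then if x = y then 1 else 0 else 0 := by
  rw [← mul_one (t.matrix * star t.matrix), matrix_mul_star_mul_entry, one_entry]

theorem matrix_mul_star_mul_matrix (t : PartialTranslation X) :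
    t.matrix * star t.matrix * t.matrix = t.matrix := by
  classical
  ext x y
  rw [matrix_mul_star_mul_entry, matrix_entry]
  split_ifs with h h' h'
  · rfl
  · rfl
  · exact absurd ⟨y, h'⟩ h
  · rfl

/-- `v v*` is a projection, so it acts as a contraction in every representation. -/
theorem isStarProjection_matrix_mul_star (t : PartialTranslation X) :
    IsStarProjection (t.matrix * star t.matrix) where
  isIdempotentElem := by
    rw [IsIdempotentElem, ← mul_assoc, matrix_mul_star_mul_matrix]
  isSelfAdjoint := IsSelfAdjoint.mul_star_self _

/-- The element `v - v v*`, whose kernel in each representation contains the invariant vectors. -/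
noncomputable def defect (t : PartialTranslation X) : TranslationAlgebra X :=
  t.matrix - t.matrix * star t.matrix

open Classical in
theorem defect_entry (t : PartialTranslation X) (x y : X) :
    t.defect.entry x y = (if (x, y) ∈ t.graph then 1 else 0) -
      if ∃ z, (x, z) ∈ t.graph then if x = y then 1 else 0 else 0 := by
  rw [defect, sub_eq_add_neg, add_entry, neg_entry, matrix_entry, matrix_mul_star_entry,
    ← sub_eq_add_neg]

end PartialTranslation

/-! ### Representations -/

section Rep

open PartialTranslation

variable {X : Type u} [EMetricSpace X] [CoarseSpace X]
variable {H : Type u} [NormedAddCommGroup H] [InnerProductSpace ℂ H] [CompleteSpace H]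

theorem mem_invariants {π : Rep X H} {ξ : H} :
    ξ ∈ invariants π ↔ ∀ t : PartialTranslation X, π t.matrix ξ = π (t.matrix * star t.matrix) ξ :=
  Iff.rfl

theorem rep_defect_apply (π : Rep X H) (t : PartialTranslation X) (ξ : H) :
    π t.defect ξ = π t.matrix ξ - π (t.matrix * star t.matrix) ξ := by
  rw [defect, map_sub, sub_apply]

theorem rep_defect_apply_of_mem_invariants (π : Rep X H) {ξ : H} (h : ξ ∈ invariants π)
    (t : PartialTranslation X) : π t.defect ξ = 0 := by
  rw [rep_defect_apply, h t, sub_self]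

theorem norm_rep_matrix_mul_star_le (π : Rep X H) (t : PartialTranslation X) :
    ‖π (t.matrix * star t.matrix)‖ ≤ 1 :=
  (t.isStarProjection_matrix_mul_star.map π).norm_le

theorem norm_rep_matrix_le (π : Rep X H) (t : PartialTranslation X) : ‖π t.matrix‖ ≤ 1 := by
  have h := norm_rep_matrix_mul_star_le π t
  rw [map_mul, map_star, CStarRing.norm_self_mul_star] at h
  nlinarith [norm_nonneg (π t.matrix)]

theorem norm_rep_defect_le (π : Rep X H) (t : PartialTranslation X) : ‖π t.defect‖ ≤ 2 := by
  rw [defect, map_sub]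
  linarith [norm_sub_le (π t.matrix) (π (t.matrix * star t.matrix)), norm_rep_matrix_le π t,
    norm_rep_matrix_mul_star_le π t]

theorem extendRep_coe (π : Rep X H) (T : TranslationAlgebra X) :
    extendRep π (T : MaxRoe X) = π T := extend_coe _ _ T

theorem continuous_extend {B : Type*} [NormedRing B] [StarRing B] [NormedAlgebra ℂ B]
    [CStarRing B] [CompleteSpace B] (φ : TranslationAlgebra X →⋆ₐ[ℂ] B)
    (hφ : ∀ T, ‖φ T‖ ≤ ‖T‖) : Continuous (extend φ hφ) :=
  Completion.continuous_extension

theorem continuous_extendRep (π : Rep X H) : Continuous (extendRep π) := continuous_extend _ _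

theorem norm_extendRep_le (π : Rep X H) (a : MaxRoe X) : ‖extendRep π a‖ ≤ ‖a‖ := by
  induction a using Completion.induction_on with
  | hp => exact isClosed_le (continuous_extendRep π).norm continuous_norm
  | ih T =>
    rw [extendRep_coe, Completion.norm_coe]
    exact norm_rep_le T π

/-- The representations of `ℂ_u[X]` separate the points of `C*_{u,max}(X)`. -/
theorem eq_of_extendRep_eq {a b : MaxRoe X}
    (h : ∀ (H : Type u) [NormedAddCommGroup H] [InnerProductSpace ℂ H] [CompleteSpace H]
      (π : Rep X H), extendRep π a = extendRep π b) : a = b := by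
  rw [← sub_eq_zero, ← norm_eq_zero]
  refine le_antisymm (le_of_forall_pos_le_add fun ε hε => ?_) (norm_nonneg _)
  obtain ⟨T, hT⟩ := (Completion.denseRange_coe (α := TranslationAlgebra X)).exists_dist_lt (a - b)
    (half_pos hε)
  rw [dist_eq_norm] at hT
  have hT' : ‖T‖ ≤ ε / 2 := maxNorm_le (half_pos hε).le fun H _ _ _ π => by
    rw [← extendRep_coe, ← norm_neg, ← zero_sub, ← sub_self (extendRep π b)]
    nth_rw 1 [← h H π]
    rw [← map_sub, ← map_sub]
    exact (norm_extendRep_le π _).trans hT.le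
  have := norm_sub_norm_le (a - b) (T : MaxRoe X)
  rw [Completion.norm_coe] at this
  linarith

theorem IsKazhdanProjection.unique {P Q : MaxRoe X} (hP : IsKazhdanProjection P)
    (hQ : IsKazhdanProjection Q) : P = Q :=
  eq_of_extendRep_eq fun H _ _ _ π => (hP.2 H π).trans (hQ.2 H π).symm

end Rep

/-! ### Passage to a coarse component -/

section Component

theorem setIter_add {X : Type u} (E : Set (X × X)) (k l : ℕ) {x y z : X} (h : (x, y) ∈ setIter E k)
    (h' : (y, z) ∈ setIter E l) : (x, z) ∈ setIter E (k + l) := by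
  induction k generalizing x with
  | zero =>
    have hxy : x = y := h
    subst hxy
    rwa [zero_add]
  | succ k ih =>
    obtain ⟨w, hw, hw'⟩ := h
    rw [Nat.add_right_comm]
    exact ⟨w, hw, ih hw'⟩

/-- If an iterate `E^{∘ k}` contains the diagonal and `F`, then `E^{∘ k m}` contains `F` for all
`m ≥ 1`. -/
theorem mem_setIter_mul {X : Type u} {E : Set (X × X)} {k : ℕ} {S : Set X}
    (hdiag : ∀ x ∈ S, (x, x) ∈ setIter E k) {x y : X} (hx : x ∈ S)
    (h : (x, y) ∈ setIter E k) {m : ℕ} (hm : 1 ≤ m) : (x, y) ∈ setIter E (k * m) := by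
  induction m, hm using Nat.le_induction with
  | base => rwa [mul_one]
  | succ m _ ih =>
    rw [mul_add, mul_one, add_comm]
    exact setIter_add E k (k * m) (hdiag x hx) ih

variable {X : Type u} [EMetricSpace X]

theorem IsControlled.edist_lt_top {E : Set (X × X)} (hE : IsControlled E) {x y : X}
    (h : (x, y) ∈ E) : edist x y < ⊤ := by
  obtain ⟨R, -, hR⟩ := hE
  exact lt_of_le_of_lt (hR h) ENNReal.coe_lt_top

theorem IsControlled.component_iff {E : Set (X × X)} (hE : IsControlled E) {x y : X}
    (h : (x, y) ∈ E) (n : Components X) :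
    (Quotient.mk _ x : Components X) = n ↔ (Quotient.mk _ y : Components X) = n := by
  have := hE.edist_lt_top h
  exact ⟨fun hx => mem_component_of_edist_lt ⟨x, hx⟩ this,
    fun hy => mem_component_of_edist_lt ⟨y, hy⟩ (by rwa [edist_comm])⟩

/-- Every controlled generating set of the component `X_n` contains the trace on `X_n` of a controlled
generating set of `X`: in any controlled generating set of `X`, replace the part over `X_n` by it. -/
theorem exists_isControlledGenerating_extension [CoarseSpace X] (n : Components X)
    {E : Set (Component X n × Component X n)} (hE : IsControlledGenerating E) :
    ∃ E' : Set (X × X), IsControlledGenerating E' ∧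
      ∀ x y : Component X n, ((x : X), (y : X)) ∈ E' → (x, y) ∈ E := by
  obtain ⟨D, hD, hDgen⟩ := CoarseSpace.monogenic (X := X)
  obtain ⟨⟨R, hR0, hR⟩, hEgen⟩ := hE
  let D' : Set (X × X) := {p | p ∈ D ∧ (Quotient.mk _ p.1 : Components X) ≠ n}
  let E₁ : Set (X × X) := (fun p : Component X n × Component X n => ((p.1 : X), (p.2 : X))) '' E
  have hD' : IsControlled D' := hD.mono fun p hp => hp.1
  have hE₁ : IsControlled E₁ := ⟨R, hR0, by rintro _ ⟨p, hp, rfl⟩; exact hR hp⟩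
  have hE' : IsControlled (D' ∪ E₁) := hD'.union hE₁
  refine ⟨D' ∪ E₁, ⟨hE', fun F hF => ?_⟩, ?_⟩
  · have hF' : IsControlled (F ∪ {p | p.1 = p.2}) := hF.union isControlled_diag
    obtain ⟨k, hk, hFk⟩ := hDgen _ hF'
    obtain ⟨l, hl, hFl⟩ := hEgen
      {p : Component X n × Component X n | ((p.1 : X), (p.2 : X)) ∈ F ∪ {p | p.1 = p.2}} (by
        obtain ⟨S, hS0, hS⟩ := hF'
        exact ⟨S, hS0, fun p hp => hS hp⟩)
    have out : ∀ (m : ℕ) (x y : X), (Quotient.mk _ x : Components X) ≠ n →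
        (x, y) ∈ setIter D m → (x, y) ∈ setIter (D' ∪ E₁) m := by
      intro m
      induction m with
      | zero => exact fun x y _ h => h
      | succ m ih =>
        rintro x y hx ⟨z, hz, hz'⟩
        exact ⟨z, Or.inl ⟨hz, hx⟩, ih z y (fun h => hx ((hD.component_iff hz n).2 h)) hz'⟩
    have ins : ∀ (m : ℕ) (x y : Component X n), (x, y) ∈ setIter E m →
        ((x : X), (y : X)) ∈ setIter (D' ∪ E₁) m := by
      intro m
      induction m with
      | zero => exact fun x y h => congrArg Subtype.val h
      | succ m ih =>
        rintro x y ⟨z, hz, hz'⟩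
        exact ⟨z, Or.inr ⟨(x, z), hz, rfl⟩, ih z y hz'⟩
    refine ⟨k * l, Nat.one_le_iff_ne_zero.2 (by positivity), ?_⟩
    rintro ⟨x, y⟩ hxy
    by_cases hx : (Quotient.mk _ x : Components X) = n
    · have hy := (hF.component_iff hxy n).1 hx
      rw [mul_comm]
      exact mem_setIter_mul (S := {x | (Quotient.mk _ x : Components X) = n})
        (fun z hz => ins l ⟨z, hz⟩ ⟨z, hz⟩ (hFl (Or.inr rfl))) hx
        (ins l ⟨x, hx⟩ ⟨y, hy⟩ (hFl (Or.inl hxy))) hk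
    · exact mem_setIter_mul (S := {x | (Quotient.mk _ x : Components X) ≠ n})
        (fun z hz => out k z z hz (hFk (Or.inr rfl))) hx
        (out k x y hx (hFk (Or.inl hxy))) hl
  · rintro x y (h | ⟨⟨a, b⟩, hab, h⟩)
    · exact absurd x.2 h.2
    · obtain ⟨h₁, h₂⟩ := Prod.mk.inj h
      rwa [← Subtype.ext h₁, ← Subtype.ext h₂]

variable (n : Components X)

/-- The restriction of a partial translation of `X` to the component `X_n`. -/
noncomputable def PartialTranslation.restrictComponent (t : PartialTranslation X) :
    PartialTranslation (Component X n) :=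
  ofGraph {p | ((p.1 : X), (p.2 : X)) ∈ t.graph}
    (by
      obtain ⟨R, hR0, hR⟩ := t.controlled_graph
      exact ⟨R, hR0, fun p hp => hR (a := ((p.1 : X), (p.2 : X))) hp⟩)
    (fun _ _ _ h h' => Subtype.ext (t.graph_row h h'))
    (fun _ _ _ h h' => Subtype.ext (t.graph_col h h'))

/-- A partial translation of the component `X_n`, seen as a partial translation of `X`. -/
noncomputable def PartialTranslation.extendComponent
    (t : PartialTranslation (Component X n)) : PartialTranslation X :=
  ofGraph ((fun p : Component X n × Component X n => ((p.1 : X), (p.2 : X))) '' t.graph)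
    (by
      obtain ⟨R, hR0, hR⟩ := t.controlled_graph
      refine ⟨R, hR0, ?_⟩
      rintro _ ⟨p, hp, rfl⟩
      exact hR hp)
    (by
      rintro _ _ _ ⟨p, hp, h⟩ ⟨q, hq, h'⟩
      obtain ⟨rfl, rfl⟩ := Prod.mk.inj h
      obtain ⟨h₁, rfl⟩ := Prod.mk.inj h'
      rw [t.graph_row (x := p.1) hp (show (p.1, q.2) ∈ t.graph by rwa [← Subtype.ext h₁])])
    (by
      rintro _ _ _ ⟨p, hp, h⟩ ⟨q, hq, h'⟩
      obtain ⟨rfl, rfl⟩ := Prod.mk.inj h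
      obtain ⟨rfl, h₂⟩ := Prod.mk.inj h'
      rw [t.graph_col (z := p.2) hp (show (q.1, p.2) ∈ t.graph by rwa [← Subtype.ext h₂])])

variable [CoarseSpace X]

theorem restrict_matrix (t : PartialTranslation X) :
    restrict n t.matrix = (t.restrictComponent n).matrix := by
  classical
  ext x y
  rw [matrix_entry]
  exact (matrix_entry t x y).trans (by simp [restrictComponent])

theorem restrict_matrix_extendComponent (t : PartialTranslation (Component X n)) :
    restrict n (t.extendComponent n).matrix = t.matrix := by
  classical
  ext x y
  rw [matrix_entry]
  refine (matrix_entry _ _ _).trans (if_congr ?_ rfl rfl)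
  rw [extendComponent, graph_ofGraph]
  constructor
  · rintro ⟨p, hp, h⟩
    obtain ⟨h₁, h₂⟩ := Prod.mk.inj h
    rwa [← Subtype.ext h₁, ← Subtype.ext h₂]
  · exact fun h => ⟨_, h, rfl⟩

variable {H : Type u} [NormedAddCommGroup H] [InnerProductSpace ℂ H] [CompleteSpace H]

/-- A representation of `ℂ_u[X_n]` has the same invariant vectors as its composition with the
restriction map. -/
theorem invariants_comp_restrict (π : Rep (Component X n) H) :
    invariants (π.comp (restrict n)) = invariants π := by
  ext ξ
  simp only [mem_invariants, StarAlgHom.comp_apply, map_mul, map_star, restrict_matrix]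
  refine ⟨fun h t => ?_, fun h t => h _⟩
  have := h (t.extendComponent n)
  rwa [← restrict_matrix, restrict_matrix_extendComponent] at this

theorem HasPropertyT.component (hT : HasPropertyT X) : HasPropertyT (Component X n) := by
  intro E hE
  obtain ⟨E', hE', hEE'⟩ := exists_isControlledGenerating_extension n hE
  obtain ⟨c, hc, h⟩ := hT E' hE'
  refine ⟨c, hc, fun H _ _ _ π ξ hξ => ?_⟩
  rw [← invariants_comp_restrict n π] at hξ
  obtain ⟨t, ht, hle⟩ := h H (π.comp (restrict n)) ξ hξ
  refine ⟨t.restrictComponent n, ?_, ?_⟩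
  · rw [supp_matrix] at ht ⊢
    rintro ⟨x, y⟩ hxy
    refine hEE' x y (ht ?_)
    simpa [restrictComponent] using hxy
  · simpa only [StarAlgHom.comp_apply, map_mul, map_star, restrict_matrix] using hle

theorem restrictMax_coe (T : TranslationAlgebra X) :
    restrictMax n (T : MaxRoe X) = (restrict n T : MaxRoe (Component X n)) :=
  extend_coe _ _ T

theorem extendRep_restrictMax (π : Rep (Component X n) H) (a : MaxRoe X) :
    extendRep π (restrictMax n a) = extendRep (π.comp (restrict n)) a := by
  induction a using Completion.induction_on with
  | hp =>
    refine isClosed_eq ((continuous_extendRep π).comp ?_) (continuous_extendRep _)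
    exact continuous_extend ((toMaxRoe (Component X n)).comp (restrict n)) _
  | ih T => rw [restrictMax_coe, extendRep_coe, extendRep_coe, StarAlgHom.comp_apply]

theorem IsKazhdanProjection.restrictMax {P : MaxRoe X} (hP : IsKazhdanProjection P) :
    IsKazhdanProjection (restrictMax n P) :=
  ⟨hP.1.map _, fun H _ _ _ π => by
    rw [extendRep_restrictMax, hP.2 H]
    simp only [invariants_comp_restrict]⟩

end Component

/-! ### Spectral gap and existence of the Kazhdan projection -/

section Decomposition

variable {X : Type u} [EMetricSpace X]

open Classical in
/-- The `0`-`1` matrix with a given controlled support. -/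
noncomputable def indicatorMatrix (E : Set (X × X)) (hE : IsControlled E) :
    TranslationAlgebra X where
  entry x y := if (x, y) ∈ E then 1 else 0
  bounded := ⟨1, fun x y => by split_ifs <;> simp⟩
  controlled := hE.mono fun p hp => by
    by_contra h
    exact hp (if_neg h)

theorem indicatorMatrix_entry_ne_zero {E : Set (X × X)} {hE : IsControlled E} {x y : X} :
    (indicatorMatrix E hE).entry x y ≠ 0 ↔ (x, y) ∈ E := by
  simp [indicatorMatrix]

variable [CoarseSpace X]

theorem TranslationAlgebra.rowIndex_injective (T : TranslationAlgebra X) {x y z : X}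
    (hy : T.entry x y ≠ 0) (hz : T.entry x z ≠ 0) (h : T.rowIndex x y = T.rowIndex x z) :
    y = z :=
  T.piece_row (T.rowIndex x z) x y z (by simpa [piece, h] using hy) (by simpa [piece] using hz)

theorem TranslationAlgebra.exists_rowIndex_lt (T : TranslationAlgebra X) :
    ∃ N : ℕ, ∀ x y, T.entry x y ≠ 0 → T.rowIndex x y < N := by
  classical
  obtain ⟨N, hN⟩ := T.exists_row_card
  refine ⟨N, fun x y h => ?_⟩
  simp only [rowIndex, mem_row.2 h, dif_pos]
  exact (Fin.is_lt _).trans_le (hN x)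

/-- A controlled set is a finite disjoint union of graphs of partial translations: sort the points
`(x, y)` by the position of `y` in the row `x` and of `x` in the column `y`. -/
theorem IsControlled.exists_partition {E : Set (X × X)} (hE : IsControlled E) :
    ∃ (ι : Type) (_ : Fintype ι) (v : ι → PartialTranslation X), ∀ p ∈ E, ∃! i, p ∈ (v i).graph := by
  let S := indicatorMatrix E hE
  have hS : ∀ {x y}, S.entry x y ≠ 0 ↔ (x, y) ∈ E := indicatorMatrix_entry_ne_zero
  have hS' : ∀ {x y}, (star S).entry y x ≠ 0 ↔ (x, y) ∈ E := by
    intro x y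
    rw [star_entry, star_ne_zero, hS]
  obtain ⟨N, hN⟩ := S.exists_rowIndex_lt
  obtain ⟨M, hM⟩ := (star S).exists_rowIndex_lt
  refine ⟨Fin N × Fin M, inferInstance, fun i => ofGraph
    {p | p ∈ E ∧ S.rowIndex p.1 p.2 = i.1 ∧ (star S).rowIndex p.2 p.1 = i.2}
    (hE.mono fun p hp => hp.1)
    (fun x y z h h' => S.rowIndex_injective (hS.2 h.1) (hS.2 h'.1) (h.2.1.trans h'.2.1.symm))
    (fun x y z h h' => (star S).rowIndex_injective (hS'.2 h.1) (hS'.2 h'.1)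
      (h.2.2.trans h'.2.2.symm)), fun p hp => ?_⟩
  refine ⟨(⟨_, hN p.1 p.2 (hS.2 hp)⟩, ⟨_, hM p.2 p.1 (hS'.2 hp)⟩), ?_, ?_⟩
  · simp [hp]
  · rintro ⟨i, j⟩ h
    rw [graph_ofGraph] at h
    exact Prod.ext (Fin.ext h.2.1.symm) (Fin.ext h.2.2.symm)

/-- If the graph of `t` is partitioned by the graphs of the `v i`, the defect `t - t t*` is a
combination of the defects of the `v i`, with projections as coefficients. -/
theorem PartialTranslation.defect_eq_sum {ι : Type*} [Fintype ι] {v : ι → PartialTranslation X}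
    {t : PartialTranslation X} (h : ∀ p ∈ t.graph, ∃! i, p ∈ (v i).graph) :
    t.defect = ∑ i, (t.inter (v i).graph).matrix * star (t.inter (v i).graph).matrix *
      (v i).defect := by
  classical
  ext x y
  simp only [sum_entry, matrix_mul_star_mul_entry, graph_inter]
  by_cases hx : ∃ z, (x, z) ∈ t.graph
  · obtain ⟨z, hz⟩ := hx
    obtain ⟨i, hi, huniq⟩ := h _ hz
    have hi' : (x, z) ∈ t.graph ∩ (v i).graph := ⟨hz, hi⟩
    rw [Finset.sum_eq_single i, if_pos ⟨z, hi'⟩, defect_entry, defect_entry,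
      if_pos (⟨z, hz⟩ : ∃ z, (x, z) ∈ t.graph), if_pos (⟨z, hi⟩ : ∃ z, (x, z) ∈ (v i).graph)]
    · have : (x, y) ∈ t.graph ↔ (x, y) ∈ (v i).graph := by
        constructor
        · intro hy
          rwa [← t.graph_row hz hy]
        · intro hy
          rwa [← (v i).graph_row hi hy]
      simp only [this]
    · intro j _ hj
      refine if_neg ?_
      rintro ⟨w, hw, hw'⟩
      rw [← t.graph_row hz hw] at hw'
      exact hj (huniq j hw')
    · exact fun hi => absurd (Finset.mem_univ i) hi
  · have hx' : ∀ i, ¬ ∃ z, (x, z) ∈ t.graph ∩ (v i).graph :=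
      fun i ⟨z, hz, _⟩ => hx ⟨z, hz⟩
    have hy : (x, y) ∉ t.graph := fun hy => hx ⟨y, hy⟩
    rw [defect_entry, if_neg hx, if_neg hy, sub_zero]
    exact (Finset.sum_eq_zero fun i _ => if_neg (hx' i)).symm

end Decomposition

section Gap

variable {X : Type u} [EMetricSpace X] [CoarseSpace X]

/-- Property (T), tested on finitely many partial translations. -/
theorem HasPropertyT.exists_finite (hT : HasPropertyT X) :
    ∃ (ι : Type) (_ : Fintype ι) (v : ι → PartialTranslation X) (c : ℝ), 0 < c ∧
      ∀ (H : Type u) [NormedAddCommGroup H] [InnerProductSpace ℂ H] [CompleteSpace H]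
        (π : Rep X H), ∀ ξ ∈ (invariants π)ᗮ, c * ‖ξ‖ ≤ ∑ i, ‖π (v i).defect ξ‖ := by
  obtain ⟨E, hE⟩ := CoarseSpace.monogenic (X := X)
  obtain ⟨ι, _, v, hv⟩ := hE.1.exists_partition
  obtain ⟨c, hc, h⟩ := hT E hE
  refine ⟨ι, inferInstance, v, c, hc, fun H _ _ _ π ξ hξ => ?_⟩
  obtain ⟨t, ht, hle⟩ := h H π ξ hξ
  rw [supp_matrix] at ht
  rw [← map_sub, ← defect, defect_eq_sum fun p hp => hv p (ht hp), map_sum, sum_apply] at hle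
  refine hle.trans (norm_sum_le_of_le _ fun i _ => ?_)
  rw [map_mul, mul_apply_eq_comp]
  refine (ContinuousLinearMap.le_opNorm _ _).trans ?_
  exact mul_le_of_le_one_left (norm_nonneg _) (norm_rep_matrix_mul_star_le π _)

/-- The averaging operator `1 - s ∑ i, (v - v v*)* (v - v v*)` of a finite family of partial
translations. -/
noncomputable def averaging {ι : Type} [Fintype ι] (v : ι → PartialTranslation X) (s : ℝ) :
    TranslationAlgebra X :=
  1 - (s : ℂ) • ∑ i, star (v i).defect * (v i).defect

theorem isSelfAdjoint_averaging {ι : Type} [Fintype ι] (v : ι → PartialTranslation X) (s : ℝ) :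
    IsSelfAdjoint (averaging v s) := by
  refine (IsSelfAdjoint.one _).sub (IsSelfAdjoint.smul (Complex.conj_ofReal s) ?_)
  exact isSelfAdjoint_sum _ fun i _ => IsSelfAdjoint.star_mul_self _

variable {H : Type u} [NormedAddCommGroup H] [InnerProductSpace ℂ H] [CompleteSpace H]

theorem rep_averaging_apply {ι : Type} [Fintype ι] (v : ι → PartialTranslation X) (s : ℝ)
    (π : Rep X H) (ξ : H) :
    π (averaging v s) ξ = ξ - (s : ℂ) • ∑ i, star (π (v i).defect) (π (v i).defect ξ) := by
  simp only [averaging, map_sub, map_one, map_smul, map_sum, map_mul, map_star, sub_apply,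
    one_apply_eq_self, smul_apply, sum_apply, mul_apply_eq_comp]

theorem rep_averaging_apply_of_mem_invariants {ι : Type} [Fintype ι] (v : ι → PartialTranslation X)
    (s : ℝ) (π : Rep X H) {ξ : H} (hξ : ξ ∈ invariants π) : π (averaging v s) ξ = ξ := by
  simp [rep_averaging_apply, rep_defect_apply_of_mem_invariants π hξ]

/-- The averaging operator contracts by what the defects detect. With `L = ∑ i, Dᵢ* Dᵢ`, the bound
`‖Dᵢ‖ ≤ 2` gives `‖L ξ‖² ≤ s⁻¹ ⟨L ξ, ξ⟩`. -/
theorem norm_rep_averaging_sq_le {ι : Type} [Fintype ι] (v : ι → PartialTranslation X) {s : ℝ}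
    (hs : 0 ≤ s) (hs' : s * (4 * Fintype.card ι) ≤ 1) (π : Rep X H) (ξ : H) :
    ‖π (averaging v s) ξ‖ ^ 2 ≤ ‖ξ‖ ^ 2 - s * ∑ i, ‖π (v i).defect ξ‖ ^ 2 := by
  set L : H := ∑ i, star (π (v i).defect) (π (v i).defect ξ) with hL
  set q : ℝ := ∑ i, ‖π (v i).defect ξ‖ ^ 2 with hq
  have hq0 : 0 ≤ q := Finset.sum_nonneg fun _ _ => sq_nonneg _
  have hinner : RCLike.re (inner ℂ ξ L) = q := by
    rw [hL, inner_sum, map_sum]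
    refine Finset.sum_congr rfl fun i _ => ?_
    rw [ContinuousLinearMap.star_eq_adjoint, ContinuousLinearMap.adjoint_inner_right,
      inner_self_eq_norm_sq]
  have hnorm : ‖L‖ ^ 2 ≤ 4 * Fintype.card ι * q := by
    have h₁ : ‖L‖ ≤ ∑ i, 2 * ‖π (v i).defect ξ‖ := by
      refine norm_sum_le_of_le _ fun i _ => (ContinuousLinearMap.le_opNorm _ _).trans ?_
      rw [norm_star]
      exact mul_le_mul_of_nonneg_right (norm_rep_defect_le π _) (norm_nonneg _)
    calc ‖L‖ ^ 2 ≤ (∑ i, 2 * ‖π (v i).defect ξ‖) ^ 2 := by gcongr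
      _ ≤ (Fintype.card ι : ℝ) * ∑ i, (2 * ‖π (v i).defect ξ‖) ^ 2 := sq_sum_le_card_mul_sum_sq
      _ = 4 * Fintype.card ι * q := by
        simp only [mul_pow, ← Finset.mul_sum]
        ring
  rw [rep_averaging_apply, ← hL, @norm_sub_sq ℂ, inner_smul_right, norm_smul, Complex.norm_real,
    Real.norm_of_nonneg hs]
  have : RCLike.re ((s : ℂ) * inner ℂ ξ L) = s * q := by
    rw [← hinner]
    exact RCLike.re_ofReal_mul s _
  rw [this]
  have h₂ : s ^ 2 * ‖L‖ ^ 2 ≤ s * q := by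
    calc s ^ 2 * ‖L‖ ^ 2 ≤ s ^ 2 * (4 * Fintype.card ι * q) := by gcongr
      _ = (s * (4 * Fintype.card ι)) * (s * q) := by ring
      _ ≤ 1 * (s * q) := by gcongr
      _ = s * q := one_mul _
  rw [mul_pow]
  linarith

/-- Powers of an operator which fixes a closed subspace and contracts its orthogonal complement
converge geometrically to the orthogonal projection. -/
theorem norm_pow_sub_starProjection_le (K : Submodule ℂ H) [K.HasOrthogonalProjection]
    {A : H →L[ℂ] H} (hA : IsSelfAdjoint A) {r : ℝ} (hr : 0 ≤ r) (hfix : ∀ ξ ∈ K, A ξ = ξ)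
    (hcontr : ∀ ξ ∈ Kᗮ, ‖A ξ‖ ≤ r * ‖ξ‖) (k : ℕ) : ‖A ^ k - K.starProjection‖ ≤ r ^ k := by
  have hperp : ∀ ξ ∈ Kᗮ, A ξ ∈ Kᗮ := by
    intro ξ hξ η hη
    rw [← ContinuousLinearMap.adjoint_inner_left, ← ContinuousLinearMap.star_eq_adjoint,
      hA.star_eq, hfix η hη]
    exact hξ η hη
  have hpow (k : ℕ) : ∀ ξ ∈ Kᗮ, ‖(A ^ k) ξ‖ ≤ r ^ k * ‖ξ‖ := by
    induction k with
    | zero => simp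
    | succ k ih =>
      intro ξ hξ
      rw [pow_succ, mul_apply_eq_comp]
      calc ‖(A ^ k) (A ξ)‖ ≤ r ^ k * ‖A ξ‖ := ih _ (hperp ξ hξ)
        _ ≤ r ^ k * (r * ‖ξ‖) := by gcongr; exact hcontr ξ hξ
        _ = r ^ (k + 1) * ‖ξ‖ := by ring
  have hfix' (k : ℕ) : ∀ ξ ∈ K, (A ^ k) ξ = ξ := by
    intro ξ hξ
    induction k with
    | zero => simp
    | succ k ih => rw [pow_succ, mul_apply_eq_comp, hfix ξ hξ, ih]
  refine ContinuousLinearMap.opNorm_le_bound _ (by positivity) fun ξ => ?_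
  have h : (A ^ k - K.starProjection) ξ = (A ^ k) (Kᗮ.starProjection ξ) := by
    rw [Submodule.starProjection_orthogonal', sub_apply, sub_apply, one_apply_eq_self, map_sub,
      hfix' k _ (K.starProjection_apply_mem ξ)]
  rw [h]
  refine (hpow k _ (Kᗮ.starProjection_apply_mem ξ)).trans ?_
  gcongr
  exact Kᗮ.norm_starProjection_apply_le ξ

/-- Property (T) yields a self-adjoint element which fixes the invariant vectors and contracts their
orthogonal complement, uniformly over all representations. -/
theorem HasPropertyT.exists_contraction (hT : HasPropertyT X) :
    ∃ (T : TranslationAlgebra X) (r : ℝ), IsSelfAdjoint T ∧ 0 ≤ r ∧ r < 1 ∧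
      ∀ (H : Type u) [NormedAddCommGroup H] [InnerProductSpace ℂ H] [CompleteSpace H]
        (π : Rep X H), (∀ ξ ∈ invariants π, π T ξ = ξ) ∧
          ∀ ξ ∈ (invariants π)ᗮ, ‖π T ξ‖ ≤ r * ‖ξ‖ := by
  obtain ⟨ι, _, v, c, hc, h⟩ := hT.exists_finite
  set N : ℝ := ((Fintype.card ι : ℕ) : ℝ) with hN
  have hN0 : 0 ≤ N := Nat.cast_nonneg _
  -- `N + 1` instead of `N` takes care of an empty family
  set s : ℝ := (4 * (N + 1))⁻¹ with hs
  have hs0 : 0 < s := by positivity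
  have hs1 : s * (4 * N) ≤ 1 := by
    rw [hs, inv_mul_le_one₀ (by positivity)]
    linarith
  set δ : ℝ := s * (c ^ 2 / (N + 1)) with hδ
  have hδ0 : 0 < δ := by positivity
  refine ⟨averaging v s, √(1 - δ), isSelfAdjoint_averaging v s, Real.sqrt_nonneg _, ?_,
    fun H _ _ _ π => ⟨fun ξ hξ => rep_averaging_apply_of_mem_invariants v s π hξ, fun ξ hξ => ?_⟩⟩
  · rw [Real.sqrt_lt' one_pos]
    linarith
  · have h₁ := norm_rep_averaging_sq_le v hs0.le hs1 π ξ
    have h₂ : c ^ 2 / (N + 1) * ‖ξ‖ ^ 2 ≤ ∑ i, ‖π (v i).defect ξ‖ ^ 2 := by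
      rw [div_mul_eq_mul_div, div_le_iff₀ (by positivity), ← mul_pow]
      calc (c * ‖ξ‖) ^ 2 ≤ (∑ i, ‖π (v i).defect ξ‖) ^ 2 := by
            gcongr
            exact h H π ξ hξ
        _ ≤ N * ∑ i, ‖π (v i).defect ξ‖ ^ 2 := sq_sum_le_card_mul_sum_sq
        _ ≤ (N + 1) * ∑ i, ‖π (v i).defect ξ‖ ^ 2 := by
            gcongr
            linarith
        _ = _ := mul_comm _ _
    have h₃ : ‖π (averaging v s) ξ‖ ^ 2 ≤ (1 - δ) * ‖ξ‖ ^ 2 := by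
      have := mul_le_mul_of_nonneg_left h₂ hs0.le
      rw [hδ]
      linarith
    calc ‖π (averaging v s) ξ‖ ≤ √((1 - δ) * ‖ξ‖ ^ 2) := Real.le_sqrt_of_sq_le h₃
      _ = √(1 - δ) * ‖ξ‖ := by
        rw [Real.sqrt_mul' _ (sq_nonneg _), Real.sqrt_sq (norm_nonneg _)]

/-- The Kazhdan projection is the limit of the powers of a contraction as in
`HasPropertyT.exists_contraction`. They form a Cauchy sequence, because the maximal norm is the
supremum over all representations. -/
theorem HasPropertyT.exists_isKazhdanProjection (hT : HasPropertyT X) :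
    ∃ P : MaxRoe X, IsKazhdanProjection P := by
  obtain ⟨T, r, hsa, hr0, hr1, h⟩ := hT.exists_contraction
  have hpow : ∀ (H : Type u) [NormedAddCommGroup H] [InnerProductSpace ℂ H] [CompleteSpace H]
      (π : Rep X H) (k : ℕ), ‖π (T ^ k) - (invariants π).starProjection‖ ≤ r ^ k := by
    intro H _ _ _ π k
    rw [map_pow]
    exact norm_pow_sub_starProjection_le _ (hsa.map π) hr0 (h H π).1 (h H π).2 k
  have hcauchy : CauchySeq fun k => ((T ^ k : TranslationAlgebra X) : MaxRoe X) := by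
    refine cauchySeq_of_le_geometric r 2 hr1 fun k => ?_
    rw [Completion.dist_eq, dist_eq_norm]
    refine maxNorm_le (by positivity) fun H _ _ _ π => ?_
    rw [map_sub, ← sub_sub_sub_cancel_right _ _ (invariants π).starProjection]
    refine (norm_sub_le _ _).trans ?_
    have h₁ := hpow H π k
    have h₂ := hpow H π (k + 1)
    have h₃ : r ^ (k + 1) ≤ r ^ k := pow_le_pow_of_le_one hr0 hr1.le k.le_succ
    linarith
  obtain ⟨P, hP⟩ := cauchySeq_tendsto_of_complete hcauchy
  have hπP : ∀ (H : Type u) [NormedAddCommGroup H] [InnerProductSpace ℂ H] [CompleteSpace H]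
      (π : Rep X H), extendRep π P = (invariants π).starProjection := by
    intro H _ _ _ π
    refine tendsto_nhds_unique ((continuous_extendRep π).tendsto P |>.comp hP) ?_
    rw [tendsto_iff_norm_sub_tendsto_zero]
    refine squeeze_zero (fun _ => norm_nonneg _) (fun k => ?_)
      (tendsto_pow_atTop_nhds_zero_of_lt_one hr0 hr1)
    rw [Function.comp_apply, extendRep_coe]
    exact hpow H π k
  refine ⟨P, ⟨?_, ?_⟩, hπP⟩
  · refine eq_of_extendRep_eq fun H _ _ _ π => ?_
    rw [map_mul, hπP]
    exact isStarProjection_starProjection.isIdempotentElem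
  · refine eq_of_extendRep_eq fun H _ _ _ π => ?_
    rw [map_star, hπP]
    exact isStarProjection_starProjection.isSelfAdjoint

end Gap

/-! ### Finite components -/

section MatrixUnit

variable {X : Type u} [EMetricSpace X]

theorem isControlled_singleton {x y : X} (h : edist x y < ⊤) : IsControlled {(x, y)} := by
  refine ⟨(edist x y).toNNReal + 1, by positivity, ?_⟩
  rintro _ rfl
  change edist x y ≤ _
  rw [ENNReal.coe_add, ENNReal.coe_toNNReal h.ne]
  exact le_self_add

/-- The matrix unit `e_{x,y}`, as the partial translation `{y} → {x}`. -/
noncomputable def matrixUnit (x y : X) (h : edist x y < ⊤) : PartialTranslation X :=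
  ofGraph {(x, y)} (isControlled_singleton h)
    (fun _ _ _ h h' => (Prod.mk.inj h).2.trans (Prod.mk.inj h').2.symm)
    (fun _ _ _ h h' => (Prod.mk.inj h).1.trans (Prod.mk.inj h').1.symm)

@[simp] theorem graph_matrixUnit (x y : X) (h : edist x y < ⊤) :
    (matrixUnit x y h).graph = {(x, y)} := graph_ofGraph ..

end MatrixUnit

section Finite

/-- The matrix with all entries `1 / |X|`, for a finite space `X` without infinite distances. -/
noncomputable def meanMatrix (X : Type u) [EMetricSpace X] [Finite X]
    (h : ∀ x y : X, edist x y < ⊤) : TranslationAlgebra X where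
  entry _ _ := 1 / (Nat.card X : ℂ)
  bounded := ⟨_, fun _ _ => le_rfl⟩
  controlled := by
    obtain ⟨M, hM⟩ := Finite.exists_le fun p : X × X => (edist p.1 p.2).toNNReal
    refine ⟨M + 1, by positivity, fun p _ => ?_⟩
    change edist p.1 p.2 ≤ _
    rw [← ENNReal.coe_toNNReal (h p.1 p.2).ne, ENNReal.coe_le_coe]
    exact (hM p).trans le_self_add

variable {X : Type u} [EMetricSpace X] [Finite X] (h : ∀ x y : X, edist x y < ⊤)

theorem star_meanMatrix : star (meanMatrix X h) = meanMatrix X h := by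
  ext x y
  simp [meanMatrix]

variable [CoarseSpace X]

theorem defect_mul_meanMatrix (t : PartialTranslation X) : t.defect * meanMatrix X h = 0 := by
  classical
  rw [defect, sub_mul, sub_eq_zero]
  ext x y
  rw [matrix_mul_star_mul_entry]
  split_ifs with hx
  · obtain ⟨z, hz⟩ := hx
    rw [matrix_mul_entry_of_mem t _ hz]
    rfl
  · exact matrix_mul_entry_of_forall_notMem t _ (not_exists.1 hx) y

variable {H : Type u} [NormedAddCommGroup H] [InnerProductSpace ℂ H] [CompleteSpace H]

theorem rep_meanMatrix_mem_invariants (π : Rep X H) (ξ : H) :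
    π (meanMatrix X h) ξ ∈ invariants π := by
  intro t
  rw [← sub_eq_zero, ← rep_defect_apply, ← mul_apply_eq_comp, ← map_mul, defect_mul_meanMatrix,
    map_zero, zero_apply]

/-- Both `|X| meanMatrix` and `|X| 1` are sums over all `x, y`: the first one of the matrix units
`e = e_{x,y}`, the second one of `e e* = e_{x,x}`. -/
theorem rep_meanMatrix_apply_of_mem_invariants [Nonempty X] (π : Rep X H) {ξ : H}
    (hξ : ξ ∈ invariants π) : π (meanMatrix X h) ξ = ξ := by
  classical
  have := Fintype.ofFinite X
  have hcard : (Fintype.card X : ℂ) ≠ 0 := Nat.cast_ne_zero.2 Fintype.card_ne_zero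
  let e : X × X → PartialTranslation X := fun p => matrixUnit p.1 p.2 (h p.1 p.2)
  have h₁ : meanMatrix X h = (1 / (Nat.card X : ℂ)) • ∑ p, (e p).matrix := by
    ext x y
    simp [meanMatrix, sum_entry, matrix_entry, e]
  have h₂ : (1 : TranslationAlgebra X) =
      (1 / (Nat.card X : ℂ)) • ∑ p, (e p).matrix * star (e p).matrix := by
    ext x y
    simp only [e, smul_entry, sum_entry, matrix_mul_star_entry, graph_matrixUnit,
      Set.mem_singleton_iff, Prod.mk.injEq, exists_and_left, exists_eq, and_true, one_entry,
      Fintype.sum_prod_type, Finset.sum_const, Nat.card_eq_fintype_card, Finset.card_univ]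
    simp [hcard]
  have h₃ : ∀ p, π (e p).matrix ξ = π ((e p).matrix * star (e p).matrix) ξ := fun p => hξ (e p)
  calc π (meanMatrix X h) ξ = (1 / (Nat.card X : ℂ)) • ∑ p, π (e p).matrix ξ := by
        rw [h₁, map_smul, map_sum, smul_apply, sum_apply]
    _ = π ((1 / (Nat.card X : ℂ)) • ∑ p, (e p).matrix * star (e p).matrix) ξ := by
        rw [map_smul, map_sum, smul_apply, sum_apply]
        simp only [h₃]
    _ = ξ := by rw [← h₂, map_one, one_apply_eq_self]

theorem rep_meanMatrix [Nonempty X] (π : Rep X H) :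
    π (meanMatrix X h) = (invariants π).starProjection := by
  ext ξ
  refine (Submodule.eq_starProjection_of_mem_of_inner_eq_zero
    (rep_meanMatrix_mem_invariants h π ξ) fun η hη => ?_).symm
  have : IsSelfAdjoint (π (meanMatrix X h)) := IsSelfAdjoint.map (star_meanMatrix h) π
  rw [inner_sub_left, sub_eq_zero, ← ContinuousLinearMap.adjoint_inner_right,
    ← ContinuousLinearMap.star_eq_adjoint, this.star_eq,
    rep_meanMatrix_apply_of_mem_invariants h π hη]

theorem isKazhdanProjection_meanMatrix [Nonempty X] :
    IsKazhdanProjection (toMaxRoe X (meanMatrix X h)) := by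
  have hπ : ∀ (H : Type u) [NormedAddCommGroup H] [InnerProductSpace ℂ H] [CompleteSpace H]
      (π : Rep X H), extendRep π (toMaxRoe X (meanMatrix X h)) = (invariants π).starProjection :=
    fun H _ _ _ π => (extendRep_coe π _).trans (rep_meanMatrix h π)
  refine ⟨⟨eq_of_extendRep_eq fun H _ _ _ π => ?_, IsSelfAdjoint.map (star_meanMatrix h) _⟩, hπ⟩
  rw [map_mul, hπ]
  exact isStarProjection_starProjection.isIdempotentElem

end Finite

/-! ### The regular representation -/

section Regular

/-- The Hilbert space `ℓ²(X)`. -/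
abbrev EllTwo (X : Type u) : Type u := lp (fun _ : X => ℂ) 2

theorem sum_norm_sq_le {X : Type u} (η : EllTwo X) (s : Finset X) : ∑ x ∈ s, ‖η x‖ ^ 2 ≤ ‖η‖ ^ 2 := by
  simpa using lp.sum_rpow_le_norm_rpow (p := 2) (by norm_num) η s

theorem norm_sq_le_of_forall_sum_le {X : Type u} {η : EllTwo X} {C : ℝ} (hC : 0 ≤ C)
    (h : ∀ s : Finset X, ∑ x ∈ s, ‖η x‖ ^ 2 ≤ C) : ‖η‖ ^ 2 ≤ C := by
  have := lp.norm_le_of_forall_sum_le (p := 2) (by norm_num) (Real.sqrt_nonneg C) (f := η)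
    fun s => by simpa [Real.sq_sqrt hC] using h s
  calc ‖η‖ ^ 2 ≤ √C ^ 2 := by gcongr
    _ = C := Real.sq_sqrt hC

open Classical in
/-- The indicator function of a finite set, as a vector of `ℓ²(X)`. -/
noncomputable def indicatorVector {X : Type u} (F : Finset X) : EllTwo X := ∑ x ∈ F, lp.single 2 x 1

open Classical in
theorem indicatorVector_apply {X : Type u} (F : Finset X) (x : X) :
    indicatorVector F x = if x ∈ F then 1 else 0 := by
  rw [indicatorVector, lp.coeFn_sum, Finset.sum_apply]
  simp [Pi.single_apply]

theorem card_le_norm_indicatorVector_sq {X : Type u} (F : Finset X) :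
    (F.card : ℝ) ≤ ‖indicatorVector F‖ ^ 2 := by
  classical
  refine le_trans (le_of_eq ?_) (sum_norm_sq_le (indicatorVector F) F)
  rw [Finset.sum_congr rfl fun x hx => by rw [indicatorVector_apply, if_pos hx]]
  simp

variable {X : Type u} [EMetricSpace X] [CoarseSpace X]

theorem finsum_row_mul (T : TranslationAlgebra X) (η : X → ℂ) (x : X) {s : Finset X}
    (hs : T.row x ⊆ s) : ∑ᶠ y, T.entry x y * η y = ∑ y ∈ s, T.entry x y * η y :=
  finsum_eq_sum_of_support_subset _ fun _ hy => hs (mem_row.2 (left_ne_zero_of_mul hy))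

/-- The Schur test: matrices with bounded entries, and with bounded numbers of nonzero entries in
the rows and in the columns, act boundedly on `ℓ²(X)`. -/
theorem exists_sum_norm_finsum_sq_le (T : TranslationAlgebra X) :
    ∃ C : ℝ, 0 ≤ C ∧ ∀ (η : EllTwo X) (s : Finset X),
      ∑ x ∈ s, ‖∑ᶠ y, T.entry x y * η y‖ ^ 2 ≤ C ^ 2 * ‖η‖ ^ 2 := by
  classical
  obtain ⟨C, hC⟩ := T.bounded
  obtain ⟨N, hN⟩ := T.exists_row_card
  obtain ⟨M, hM⟩ := (star T).exists_row_card
  refine ⟨√(N * C ^ 2 * M), Real.sqrt_nonneg _, fun η s => ?_⟩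
  rw [Real.sq_sqrt (by positivity)]
  have hrow : ∀ x, ‖∑ᶠ y, T.entry x y * η y‖ ^ 2 ≤ N * C ^ 2 * ∑ y ∈ T.row x, ‖η y‖ ^ 2 := by
    intro x
    rw [finsum_row_mul T η x subset_rfl]
    calc ‖∑ y ∈ T.row x, T.entry x y * η y‖ ^ 2
        ≤ (∑ y ∈ T.row x, C * ‖η y‖) ^ 2 := by
          gcongr
          refine norm_sum_le_of_le _ fun y _ => ?_
          rw [norm_mul]
          gcongr
          exact hC x y
      _ ≤ (T.row x).card * ∑ y ∈ T.row x, (C * ‖η y‖) ^ 2 := sq_sum_le_card_mul_sum_sq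
      _ ≤ N * ∑ y ∈ T.row x, (C * ‖η y‖) ^ 2 := by
          gcongr
          exact hN x
      _ = N * C ^ 2 * ∑ y ∈ T.row x, ‖η y‖ ^ 2 := by
          simp only [mul_pow, ← Finset.mul_sum]
          ring
  have hsub : ∀ y, s.filter (fun x => y ∈ T.row x) ⊆ (star T).row y := by
    intro y x hx
    rw [Finset.mem_filter, mem_row] at hx
    rw [mem_row, star_entry, star_ne_zero]
    exact hx.2
  calc ∑ x ∈ s, ‖∑ᶠ y, T.entry x y * η y‖ ^ 2
      ≤ ∑ x ∈ s, N * C ^ 2 * ∑ y ∈ T.row x, ‖η y‖ ^ 2 := Finset.sum_le_sum fun x _ => hrow x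
    _ = N * C ^ 2 * ∑ y ∈ s.biUnion T.row, ∑ x ∈ s with y ∈ T.row x, ‖η y‖ ^ 2 := by
        rw [← Finset.mul_sum]
        congr 1
        refine Finset.sum_comm' fun x y => ?_
        simp only [Finset.mem_filter, Finset.mem_biUnion]
        exact ⟨fun h => ⟨h, x, h⟩, fun h => h.1⟩
    _ ≤ N * C ^ 2 * ∑ y ∈ s.biUnion T.row, M * ‖η y‖ ^ 2 := by
        gcongr with y
        rw [Finset.sum_const, nsmul_eq_mul]
        gcongr
        exact (Finset.card_le_card (hsub y)).trans (hM y)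
    _ = N * C ^ 2 * M * ∑ y ∈ s.biUnion T.row, ‖η y‖ ^ 2 := by
        rw [← Finset.mul_sum]
        ring
    _ ≤ N * C ^ 2 * M * ‖η‖ ^ 2 := by
        gcongr
        exact sum_norm_sq_le η _

/-- The operator on `ℓ²(X)` given by a matrix of the translation algebra. -/
noncomputable def regularOperator (T : TranslationAlgebra X) : EllTwo X →L[ℂ] EllTwo X :=
  LinearMap.mkContinuousOfExistsBound
    { toFun := fun η => ⟨fun x => ∑ᶠ y, T.entry x y * η y, by
        obtain ⟨C, -, hC⟩ := exists_sum_norm_finsum_sq_le T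
        exact memℓp_gen' fun s => by simpa using hC η s⟩
      map_add' := fun η ζ => by
        ext x
        change ∑ᶠ y, T.entry x y * (η + ζ) y =
          (∑ᶠ y, T.entry x y * η y) + ∑ᶠ y, T.entry x y * ζ y
        simp only [finsum_row_mul T _ x subset_rfl, ← Finset.sum_add_distrib, ← mul_add]
        rfl
      map_smul' := fun c η => by
        ext x
        change ∑ᶠ y, T.entry x y * (c • η) y = c * ∑ᶠ y, T.entry x y * η y
        simp only [finsum_row_mul T _ x subset_rfl, Finset.mul_sum]
        refine Finset.sum_congr rfl fun y _ => ?_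
        rw [lp.coeFn_smul, Pi.smul_apply, smul_eq_mul, mul_left_comm] }
    (by
      obtain ⟨C, hC0, hC⟩ := exists_sum_norm_finsum_sq_le T
      refine ⟨C, fun η => le_of_sq_le_sq ?_ (by positivity)⟩
      rw [mul_pow]
      exact norm_sq_le_of_forall_sum_le (by positivity) (hC η))

theorem regularOperator_apply (T : TranslationAlgebra X) (η : EllTwo X) (x : X) :
    regularOperator T η x = ∑ᶠ y, T.entry x y * η y := rfl

theorem regularOperator_apply_sum (T : TranslationAlgebra X) (η : EllTwo X) (x : X) {s : Finset X}
    (hs : T.row x ⊆ s) : regularOperator T η x = ∑ y ∈ s, T.entry x y * η y :=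
  finsum_row_mul T η x hs

theorem regularOperator_one : regularOperator (1 : TranslationAlgebra X) = 1 := by
  classical
  ext η x
  rw [regularOperator_apply, finsum_eq_single _ x fun y hy => by simp [hy.symm]]
  simp

theorem regularOperator_mul (T S : TranslationAlgebra X) :
    regularOperator (T * S) = regularOperator T * regularOperator S := by
  classical
  ext η x
  have h : (T * S).row x ⊆ (T.row x).biUnion S.row := by
    intro z hz
    rw [mem_row] at hz
    obtain ⟨w, hw⟩ := exists_ne_of_finsum hz
    exact Finset.mem_biUnion.2 ⟨w, mem_row.2 (left_ne_zero_of_mul hw),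
      mem_row.2 (right_ne_zero_of_mul hw)⟩
  rw [mul_apply_eq_comp, regularOperator_apply_sum _ η x h,
    regularOperator_apply_sum T _ x subset_rfl]
  simp only [mul_entry_sum T S x _ subset_rfl, Finset.sum_mul]
  rw [Finset.sum_comm]
  refine Finset.sum_congr rfl fun w hw => ?_
  rw [regularOperator_apply_sum S η w (Finset.subset_biUnion_of_mem S.row hw), Finset.mul_sum]
  exact Finset.sum_congr rfl fun z _ => mul_assoc _ _ _

theorem regularOperator_add (T S : TranslationAlgebra X) :
    regularOperator (T + S) = regularOperator T + regularOperator S := by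
  classical
  ext η x
  have h : (T + S).row x ⊆ T.row x ∪ S.row x := by
    intro z hz
    rw [mem_row] at hz
    by_contra h
    simp only [Finset.mem_union, mem_row, not_or, not_not] at h
    exact hz (by simp [h])
  rw [add_apply, lp.coeFn_add, Pi.add_apply, regularOperator_apply_sum _ η x h,
    regularOperator_apply_sum T η x (Finset.subset_union_left (s₂ := S.row x)),
    regularOperator_apply_sum S η x (Finset.subset_union_right (s₁ := T.row x)),
    ← Finset.sum_add_distrib]
  simp only [add_entry, add_mul]

theorem regularOperator_smul (c : ℂ) (T : TranslationAlgebra X) :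
    regularOperator (c • T) = c • regularOperator T := by
  ext η x
  have h : (c • T).row x ⊆ T.row x := fun z hz => by
    rw [mem_row] at hz ⊢
    exact right_ne_zero_of_mul hz
  rw [smul_apply, lp.coeFn_smul, Pi.smul_apply, regularOperator_apply_sum _ η x h,
    regularOperator_apply_sum T η x subset_rfl, smul_eq_mul, Finset.mul_sum]
  simp only [smul_entry, mul_assoc]

theorem regularOperator_star (T : TranslationAlgebra X) :
    regularOperator (star T) = star (regularOperator T) := by
  classical
  ext η x
  have hcol : ∀ y, regularOperator T (lp.single 2 x 1) y = T.entry y x := by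
    intro y
    rw [regularOperator_apply, finsum_eq_single _ x fun z hz => by simp [hz]]
    simp
  have h : star (regularOperator T) η x =
      inner ℂ (lp.single 2 x (1 : ℂ)) (star (regularOperator T) η) := by
    rw [lp.inner_single_left]
    simp
  rw [h, ContinuousLinearMap.star_eq_adjoint, ContinuousLinearMap.adjoint_inner_right,
    lp.inner_eq_tsum, regularOperator_apply_sum _ η x subset_rfl,
    tsum_eq_sum (s := (star T).row x) fun y hy => ?_]
  · refine Finset.sum_congr rfl fun y _ => ?_
    rw [hcol, star_entry, RCLike.inner_apply, mul_comm]
    rfl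
  · rw [mem_row, not_not, star_entry, star_eq_zero] at hy
    rw [hcol, hy, inner_zero_left]

variable (X) in
/-- The regular representation of the translation algebra on `ℓ²(X)`. -/
noncomputable def regularRep : Rep X (EllTwo X) where
  toFun := regularOperator
  map_one' := regularOperator_one
  map_mul' := regularOperator_mul
  map_zero' := by rw [← zero_smul ℂ (0 : TranslationAlgebra X), regularOperator_smul, zero_smul]
  map_add' := regularOperator_add
  commutes' c := by
    rw [Algebra.algebraMap_eq_smul_one, Algebra.algebraMap_eq_smul_one, regularOperator_smul,
      regularOperator_one]
  map_star' := regularOperator_star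

open Classical in
theorem regularRep_defect_apply (t : PartialTranslation X) (η : EllTwo X) {x z : X}
    (h : (x, z) ∈ t.graph) : regularRep X t.defect η x = η z - η x := by
  change regularOperator t.defect η x = _
  have hrow : t.defect.row x ⊆ {z, x} := by
    intro y hy
    rw [mem_row, defect_entry] at hy
    rw [Finset.mem_insert, Finset.mem_singleton]
    by_contra! hne
    refine hy ?_
    rw [if_neg fun hy => hne.1 (t.graph_row hy h), if_neg hne.2.symm, ite_self, sub_zero]
  have hxx : ∀ y, (x, y) ∈ t.graph ↔ y = z :=
    fun y => ⟨fun hy => t.graph_row hy h, fun hy => hy ▸ h⟩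
  rw [regularOperator_apply_sum _ η x hrow]
  simp only [defect_entry, hxx, sub_mul, Finset.sum_sub_distrib, ite_mul, one_mul, zero_mul,
    Finset.sum_ite_eq']
  simp

theorem regularRep_defect_apply_of_forall_notMem (t : PartialTranslation X) (η : EllTwo X) {x : X}
    (h : ∀ z, (x, z) ∉ t.graph) : regularRep X t.defect η x = 0 := by
  classical
  change regularOperator t.defect η x = 0
  rw [regularOperator_apply]
  refine finsum_eq_zero_of_forall_eq_zero fun y => ?_
  rw [defect_entry, if_neg (h y), if_neg (not_exists.2 h), sub_zero, zero_mul]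

/-- Invariant vectors of the regular representation are constant functions, and those in `ℓ²(X)`
vanish if `X` is infinite. -/
theorem invariants_regularRep [Infinite X] (h : ∀ x y : X, edist x y < ⊤) :
    invariants (regularRep X) = ⊥ := by
  refine (Submodule.eq_bot_iff _).2 fun η hη => ?_
  have hconst : ∀ x y, η y = η x := by
    intro x y
    rw [← sub_eq_zero, ← regularRep_defect_apply (matrixUnit x y (h x y)) η (by simp),
      rep_defect_apply_of_mem_invariants _ hη]
    rfl
  ext x
  change η x = 0
  by_contra hx
  have hpos : 0 < ‖η x‖ ^ 2 := by positivity
  obtain ⟨k, hk⟩ := exists_nat_gt (‖η‖ ^ 2 / ‖η x‖ ^ 2)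
  obtain ⟨s, hs⟩ := Infinite.exists_subset_card_eq X k
  have := sum_norm_sq_le η s
  simp only [hconst x, Finset.sum_const, hs, nsmul_eq_mul] at this
  rw [div_lt_iff₀ hpos] at hk
  linarith

end Regular

/-! ### Isoperimetry and paradoxical decompositions -/

section Neighborhood

variable {X : Type u} [EMetricSpace X] [CoarseSpace X]

theorem finite_closedEBall (x : X) (r : ℝ≥0) : (Metric.closedEBall x (r : ℝ≥0∞)).Finite := by
  obtain ⟨N, hN⟩ := CoarseSpace.bounded_geometry (X := X) (r + 1) (by positivity)
  refine (Set.finite_of_encard_le_coe (hN x)).subset (Metric.closedEBall_subset_closedEBall ?_)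
  rw [ENNReal.coe_add]
  exact le_self_add

open Classical in
/-- The closed `r`-neighborhood of a finite set. -/
noncomputable def nhd (F : Finset X) (r : ℝ≥0) : Finset X :=
  F.biUnion fun y => (finite_closedEBall y r).toFinset

theorem mem_nhd {F : Finset X} {r : ℝ≥0} {x : X} : x ∈ nhd F r ↔ ∃ y ∈ F, edist x y ≤ r := by
  simp [nhd]

theorem subset_nhd (F : Finset X) (r : ℝ≥0) : F ⊆ nhd F r :=
  fun x hx => mem_nhd.2 ⟨x, hx, by simp⟩

theorem nhd_nhd_subset (F : Finset X) (r s : ℝ≥0) : nhd (nhd F r) s ⊆ nhd F (r + s) := by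
  intro x hx
  obtain ⟨y, hy, hxy⟩ := mem_nhd.1 hx
  obtain ⟨z, hz, hyz⟩ := mem_nhd.1 hy
  refine mem_nhd.2 ⟨z, hz, (edist_triangle x y z).trans ?_⟩
  rw [ENNReal.coe_add, add_comm (r : ℝ≥0∞)]
  exact add_le_add hxy hyz

/-- The defect of `t` moves the indicator function of `F` only at the points of `nhd F r \ F` and at
the points of `F` which `t⁻¹` sends there. -/
theorem norm_regularRep_defect_indicatorVector_sq_le (t : PartialTranslation X) {r : ℝ≥0}
    (ht : t.graph ⊆ tube X r) (F : Finset X) :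
    ‖regularRep X t.defect (indicatorVector F)‖ ^ 2 ≤ 2 * ((nhd F r).card - F.card : ℝ) := by
  classical
  set f : X → ℂ := fun x => regularRep X t.defect (indicatorVector F) x with hf
  set A : Finset X := nhd F r \ F with hA
  set B : Finset X := F.filter fun x => ∃ z ∈ A, (x, z) ∈ t.graph with hB
  have hAcard : (A.card : ℝ) = (nhd F r).card - F.card := by
    rw [hA, Finset.card_sdiff_of_subset (subset_nhd F r),
      Nat.cast_sub (Finset.card_le_card (subset_nhd F r))]
  have hBcard : B.card ≤ A.card := by
    choose! g hg using fun x (hx : x ∈ B) => (Finset.mem_filter.1 hx).2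
    refine Finset.card_le_card_of_injOn g (fun x hx => (hg x hx).1) fun x hx y hy hxy => ?_
    refine t.graph_col (hg x hx).2 ?_
    rw [hxy]
    exact (hg y hy).2
  have hnorm : ∀ x, ‖f x‖ ^ 2 ≤ if x ∈ A ∪ B then 1 else 0 := by
    intro x
    by_cases hx : ∃ z, (x, z) ∈ t.graph
    · obtain ⟨z, hz⟩ := hx
      have hxz : edist x z ≤ r := ht hz
      have hfx : f x = (if z ∈ F then 1 else 0) - if x ∈ F then 1 else 0 := by
        rw [hf]
        simp only
        rw [regularRep_defect_apply t _ hz, indicatorVector_apply, indicatorVector_apply]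
      by_cases hzF : z ∈ F <;> by_cases hxF : x ∈ F
      · rw [hfx, if_pos hzF, if_pos hxF]
        split_ifs <;> simp
      · rw [if_pos, hfx, if_pos hzF, if_neg hxF]
        · simp
        · exact Finset.mem_union_left _ (Finset.mem_sdiff.2 ⟨mem_nhd.2 ⟨z, hzF, hxz⟩, hxF⟩)
      · rw [if_pos, hfx, if_neg hzF, if_pos hxF]
        · simp
        · refine Finset.mem_union_right _ (Finset.mem_filter.2 ⟨hxF, z, ?_, hz⟩)
          exact Finset.mem_sdiff.2 ⟨mem_nhd.2 ⟨x, hxF, by rwa [edist_comm]⟩, hzF⟩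
      · rw [hfx, if_neg hzF, if_neg hxF]
        split_ifs <;> simp
    · have hfx : f x = 0 := regularRep_defect_apply_of_forall_notMem t _ (not_exists.1 hx)
      rw [hfx]
      split_ifs <;> simp
  rw [← hAcard]
  refine norm_sq_le_of_forall_sum_le (by positivity) fun s => ?_
  calc ∑ x ∈ s, ‖f x‖ ^ 2 ≤ ∑ x ∈ s, if x ∈ A ∪ B then (1 : ℝ) else 0 :=
        Finset.sum_le_sum fun x _ => hnorm x
    _ = ((s.filter (· ∈ A ∪ B)).card : ℝ) := by rw [Finset.sum_boole]
    _ ≤ ((A ∪ B).card : ℝ) := by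
        gcongr
        exact fun x hx => (Finset.mem_filter.1 hx).2
    _ ≤ A.card + B.card := by exact_mod_cast Finset.card_union_le A B
    _ ≤ 2 * (A.card : ℝ) := by
        have : (B.card : ℝ) ≤ A.card := by exact_mod_cast hBcard
        linarith

/-- Without invariant vectors in `ℓ²(X)`, Property (T) is an isoperimetric inequality: apply it to
indicator functions. -/
theorem HasPropertyT.exists_expansion (hT : HasPropertyT X) [Infinite X]
    (h : ∀ x y : X, edist x y < ⊤) :
    ∃ (r : ℝ≥0) (δ : ℝ), 0 < δ ∧ ∀ F : Finset X, (1 + δ) * F.card ≤ (nhd F r).card := by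
  obtain ⟨E, hE⟩ := CoarseSpace.monogenic (X := X)
  obtain ⟨r, -, hr⟩ := hE.1
  obtain ⟨c, hc, hcT⟩ := hT E hE
  refine ⟨r, c ^ 2 / 2, by positivity, fun F => ?_⟩
  obtain ⟨t, ht, hle⟩ := hcT (EllTwo X) (regularRep X) (indicatorVector F)
    (by rw [invariants_regularRep h, Submodule.bot_orthogonal_eq_top]; trivial)
  rw [supp_matrix] at ht
  rw [← map_sub, ← defect] at hle
  have h₁ := norm_regularRep_defect_indicatorVector_sq_le t (ht.trans hr) F
  have h₂ : c ^ 2 * F.card ≤ ‖regularRep X t.defect (indicatorVector F)‖ ^ 2 := by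
    calc c ^ 2 * F.card ≤ c ^ 2 * ‖indicatorVector F‖ ^ 2 := by
          gcongr
          exact card_le_norm_indicatorVector_sq F
      _ = (c * ‖indicatorVector F‖) ^ 2 := by ring
      _ ≤ _ := by gcongr
  linarith

theorem HasPropertyT.exists_doubling (hT : HasPropertyT X) [Infinite X]
    (h : ∀ x y : X, edist x y < ⊤) :
    ∃ r : ℝ≥0, ∀ F : Finset X, 2 * F.card ≤ (nhd F r).card := by
  obtain ⟨r, δ, hδ, hexp⟩ := hT.exists_expansion h
  have hiter : ∀ (k : ℕ) (F : Finset X), (1 + δ) ^ k * F.card ≤ (nhd F (k * r)).card := by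
    intro k F
    induction k with
    | zero =>
      rw [pow_zero, one_mul]
      exact_mod_cast Finset.card_le_card (subset_nhd F _)
    | succ k ih =>
      have hsub : nhd (nhd F (k * r)) r ⊆ nhd F ((k + 1 : ℕ) * r) := by
        refine (nhd_nhd_subset F _ _).trans_eq ?_
        congr 1
        push_cast
        ring
      calc (1 + δ) ^ (k + 1) * F.card = (1 + δ) * ((1 + δ) ^ k * F.card) := by ring
        _ ≤ (1 + δ) * (nhd F (k * r)).card := by gcongr
        _ ≤ (nhd (nhd F (k * r)) r).card := hexp _
        _ ≤ _ := by exact_mod_cast Finset.card_le_card hsub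
  obtain ⟨k, hk⟩ := pow_unbounded_of_one_lt 2 (show 1 < 1 + δ by linarith)
  refine ⟨k * r, fun F => ?_⟩
  have : (2 : ℝ) * F.card ≤ (nhd F (k * r)).card :=
    (mul_le_mul_of_nonneg_right hk.le (Nat.cast_nonneg _)).trans (hiter k F)
  exact_mod_cast this

/-- A doubling space is paradoxical: by Hall's marriage theorem there are two injections of `X` into
itself with disjoint ranges, at bounded distance from the identity. -/
theorem exists_paradoxical {r : ℝ≥0} (hr : ∀ F : Finset X, 2 * F.card ≤ (nhd F r).card) :
    ∃ t₁ t₂ : PartialTranslation X, star t₁.matrix * t₁.matrix = 1 ∧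
      star t₂.matrix * t₂.matrix = 1 ∧ star t₁.matrix * t₂.matrix = 0 := by
  classical
  obtain ⟨f, hinj, hf⟩ := (Finset.all_card_le_biUnion_card_iff_exists_injective
    fun p : X × Bool => (finite_closedEBall p.1 r).toFinset).1 fun S => by
      have h₁ : S ⊆ S.image Prod.fst ×ˢ Finset.univ := fun p hp =>
        Finset.mem_product.2 ⟨Finset.mem_image_of_mem _ hp, Finset.mem_univ _⟩
      have h₂ : S.biUnion (fun p => (finite_closedEBall p.1 r).toFinset) =
          nhd (S.image Prod.fst) r := by
        rw [nhd, Finset.image_biUnion]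
      calc S.card ≤ (S.image Prod.fst).card * 2 := by
            simpa [Finset.card_product] using Finset.card_le_card h₁
        _ ≤ _ := by
            rw [mul_comm, h₂]
            exact hr _
  have hf' : ∀ y b, edist (f (y, b)) y ≤ r := fun y b => by simpa using hf (y, b)
  let t : Bool → PartialTranslation X := fun b => ofGraph {p | p.1 = f (p.2, b)}
    ⟨r + 1, by positivity, by
      rintro ⟨x, y⟩ hxy
      have hxy : x = f (y, b) := hxy
      change edist x y ≤ _
      rw [hxy, ENNReal.coe_add]
      exact (hf' y b).trans le_self_add⟩
    (fun x y z (hy : x = f (y, b)) (hz : x = f (z, b)) =>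
      (Prod.mk.inj (hinj (hy.symm.trans hz))).1)
    (fun x y z (hx : x = f (z, b)) (hy : y = f (z, b)) => hx.trans hy.symm)
  have hmem : ∀ b x y, (x, y) ∈ (t b).graph ↔ x = f (y, b) := fun b x y => by
    rw [show (t b).graph = _ from graph_ofGraph ..]
    rfl
  have hmem' : ∀ b x y, (y, x) ∈ (t b).symm.graph ↔ x = f (y, b) := fun b x y =>
    mem_graph_symm.trans (hmem b x y)
  have hmul : ∀ b c y z, (star (t b).matrix * (t c).matrix).entry y z =
      if f (y, b) = f (z, c) then 1 else 0 := by
    intro b c y z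
    rw [← matrix_symm, matrix_mul_entry_of_mem _ _ ((hmem' b _ y).2 rfl), matrix_entry, hmem]
  have hone : ∀ b, star (t b).matrix * (t b).matrix = 1 := by
    intro b
    ext y z
    rw [hmul, one_entry, hinj.eq_iff]
    simp
  refine ⟨t true, t false, hone _, hone _, ?_⟩
  ext y z
  rw [hmul, if_neg fun h => by simpa using hinj h, zero_entry]

variable {H : Type u} [NormedAddCommGroup H] [InnerProductSpace ℂ H] [CompleteSpace H]

/-- An invariant vector is fixed by each everywhere defined partial translation `v`: both `‖π(v) ξ‖²`
and `⟨π(v) ξ, ξ⟩ = ⟨ξ, π(v*) ξ⟩` equal `‖ξ‖²`, since `π(v*) ξ = π(v* v) ξ`. -/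
theorem rep_matrix_apply_of_mem_invariants (π : Rep X H) {ξ : H} (hξ : ξ ∈ invariants π)
    (t : PartialTranslation X) (ht : star t.matrix * t.matrix = 1) : π t.matrix ξ = ξ := by
  have hstar : star (π t.matrix) ξ = ξ := by
    have := hξ t.symm
    rwa [matrix_symm, star_star, ht, map_one, one_apply_eq_self, map_star] at this
  have hmul : star (π t.matrix) (π t.matrix ξ) = ξ := by
    rw [← mul_apply_eq_comp, ← map_star, ← map_mul, ht, map_one, one_apply_eq_self]
  have h₁ : inner ℂ (π t.matrix ξ) ξ = inner ℂ ξ ξ := by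
    rw [← ContinuousLinearMap.adjoint_inner_right, ← ContinuousLinearMap.star_eq_adjoint, hstar]
  have h₂ : inner ℂ (π t.matrix ξ) (π t.matrix ξ) = inner ℂ ξ ξ := by
    rw [← ContinuousLinearMap.adjoint_inner_right, ← ContinuousLinearMap.star_eq_adjoint, hmul]
  rw [← sub_eq_zero, ← inner_self_eq_zero (𝕜 := ℂ), inner_sub_left, inner_sub_right,
    inner_sub_right, h₁, h₂, ← inner_conj_symm ξ (π t.matrix ξ), h₁, inner_self_conj]
  ring

/-- On an infinite space with Property (T) and without infinite distances, no representation has a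
nonzero invariant vector: it would be fixed by two isometries with orthogonal ranges. -/
theorem HasPropertyT.invariants_eq_bot (hT : HasPropertyT X) [Infinite X]
    (h : ∀ x y : X, edist x y < ⊤) (π : Rep X H) : invariants π = ⊥ := by
  obtain ⟨r, hr⟩ := hT.exists_doubling h
  obtain ⟨t₁, t₂, h₁, h₂, h₁₂⟩ := exists_paradoxical hr
  refine (Submodule.eq_bot_iff _).2 fun ξ hξ => ?_
  calc ξ = π (star t₁.matrix * t₁.matrix) ξ := by rw [h₁, map_one, one_apply_eq_self]
    _ = π (star t₁.matrix) (π t₂.matrix ξ) := by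
        rw [map_mul, mul_apply_eq_comp, rep_matrix_apply_of_mem_invariants π hξ t₁ h₁,
          rep_matrix_apply_of_mem_invariants π hξ t₂ h₂]
    _ = 0 := by rw [← mul_apply_eq_comp, ← map_mul, h₁₂, map_zero, zero_apply]

theorem HasPropertyT.isKazhdanProjection_zero (hT : HasPropertyT X) [Infinite X]
    (h : ∀ x y : X, edist x y < ⊤) : IsKazhdanProjection (0 : MaxRoe X) :=
  ⟨.zero _, fun H _ _ _ π => by
    rw [map_zero]
    simp only [hT.invariants_eq_bot h π, Submodule.starProjection_bot]⟩

end Neighborhood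

end Coarse

theorem corollary2 {X : Type u} [EMetricSpace X] [Coarse.CoarseSpace X]
    (hT : Coarse.HasPropertyT X) :
    (∀ n : Coarse.Components X, Coarse.HasPropertyT (Coarse.Component X n)) ∧
    (∃! P : Coarse.MaxRoe X, Coarse.IsKazhdanProjection P) ∧
    ∀ P : Coarse.MaxRoe X, Coarse.IsKazhdanProjection P → ∀ n : Coarse.Components X,
      Coarse.IsKazhdanProjection (Coarse.restrictMax n P) ∧
      ∃ T : Coarse.TranslationAlgebra (Coarse.Component X n),
        Coarse.restrictMax n P = Coarse.toMaxRoe (Coarse.Component X n) T ∧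
        (Finite (Coarse.Component X n) →
          ∀ x y, T.entry x y = 1 / (Nat.card (Coarse.Component X n) : ℂ)) ∧
        (Infinite (Coarse.Component X n) → ∀ x y, T.entry x y = 0) := by
  obtain ⟨P₀, hP₀⟩ := hT.exists_isKazhdanProjection
  refine ⟨fun n => hT.component n, ⟨P₀, hP₀, fun P hP => hP.unique hP₀⟩, fun P hP n => ?_⟩
  have hPn := hP.restrictMax n
  have hn : ∀ x y : Coarse.Component X n, edist x y < ⊤ := Coarse.component_edist_lt
  have : Nonempty (Coarse.Component X n) := by
    induction n using Quotient.inductionOn with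
    | _ x => exact ⟨⟨x, rfl⟩⟩
  refine ⟨hPn, ?_⟩
  rcases finite_or_infinite (Coarse.Component X n) with hfin | hinf
  · exact ⟨Coarse.meanMatrix _ hn, hPn.unique (Coarse.isKazhdanProjection_meanMatrix hn),
      fun _ _ _ => rfl, fun hinf => (not_finite (Coarse.Component X n)).elim⟩
  · refine ⟨0, ?_, fun hfin => (not_finite (Coarse.Component X n)).elim, fun _ _ _ => rfl⟩
    rw [map_zero]
    exact hPn.unique ((hT.component n).isKazhdanProjection_zero hn)
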